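/- **Setting.** Let $\mathbb F_q$ be a finite field of characteristic different from $2$ and $3$, let $f=x^3+Ax+B\in\mathbb F_q[x]$ have no multiple roots, and let $E$ be the elliptic curve $y^2=f(x)$ with neutral element $P_\infty$. Let $\varphi$ be the $q$-Frobenius endomorphism of $E(\mathbb F_{q^3})$, and assume that the trace-zero subgroup $T_3=\{Q\in E(\mathbb F_{q^3}) : Q+\varphi(Q)+\varphi^2(Q)=P_\infty\}$ is cyclic of prime order $p>3$, generated by $P$. For $Q\in T_3\setminus\{P_\infty\}$ let $h_Q=y-(\alpha_1x+\alpha_0)$, with $\alpha_0,\alpha_1\in\mathbb F_q$, be the line through $Q,\varphi(Q),\varphi^2(Q)$; thus $h_{-Q}(x,y)=-h_Q(x,-y)$. For $Q,R\in T_3\setminus\{P_\infty\}$ let $$S_{Q,R}=(S_{Q,R})_1+y\,(S_{Q,R})_2=(a_4x^4+a_3x^3+a_2x^2+a_1x+a_0)+y(b_3x^3+b_2x^2+b_1x+b_0)$$ be the polynomial over $\mathbb F_q$, unique up to a nonzero constant, with divisor $\sum_{0\le i,j\le 2}(\varphi^i(Q)+\varphi^j(R))-9P_\infty$ on $E$,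 scaled so that $b_3=1$ whenever $b_3\ne0$. For $h_Q\neq h_R$ the subalgorithm computes it from the coefficients of $h_Q$ and $h_R$ by explicit formulas, in which each $a_i,b_i$ is, before scaling, an integer polynomial in $A$, $B$ and these coefficients (the formulas are spelled out in the formal definitions). For $W=x^3+w_2x^2+w_1x+w_0$ and $S=S_1+yS_2$ with coefficients $a_i,b_i$ as above, let $L(W,S)$ be the linear system in $(\gamma_1,\gamma_0)$ with augmented matrix $$\begin{pmatrix} w_0(w_2-b_2) & b_0-w_0 & w_0a_3-a_4w_2w_0-a_0\\ w_0(w_1-b_1) & b_0w_2-w_0b_2 & w_0a_2-a_4w_1w_0-a_0w_2\\ w_0(w_0-b_0) & b_0w_1-b_1w_0 & w_0a_1-a_4w_0^2-a_0w_1\end{pmatrix}.$$ "Solving $L(W,S)$" means returning $y-(\gamma_1x+\gamma_0)$ for its unique solution; the subalgorithm fails if a system that it has to solve does not have exactly one solution. **Subalgorithm.** Input: the lines $h_{m_1P},h_{m_2P},h_{n_1P},h_{n_2P}$. 1. If $h_{m_1P}=h_{m_2P}$, return $-h_{m_1P}(x,-y)$. If $h_{n_1P}=h_{n_2P}$, return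 $-h_{n_1P}(x,-y)$. 2. Compute $S_1=S_{1,1}+yS_{1,2}:=S_{m_1P,m_2P}$ and $S_2=S_{2,1}+yS_{2,2}:=S_{n_1P,n_2P}$. 3. If $h_{m_1P}(x,y)=-h_{m_2P}(x,-y)$, let $W$ be the monic multiple of $S_{1,1}$, solve $L(W,S_2)$ and return the result. If $h_{n_1P}(x,y)=-h_{n_2P}(x,-y)$, let $W$ be the monic multiple of $S_{2,1}$, solve $L(W,S_1)$ and return the result. 4. Let $G=\gcd(fS_{1,2}^2-S_{1,1}^2,\ fS_{2,2}^2-S_{2,1}^2)$ and let $W_1,\dots,W_s$ be the distinct monic irreducible factors of $G$ of degree $3$ in $\mathbb F_q[x]$, in any order. 5. For $W=W_1,\dots,W_s$ in turn: if $W\ne S_{1,2}$, solve $L(W,S_1)$ to get $h=y-(\gamma_1x+\gamma_0)$, and return $h$ if $W\mid(\gamma_1x+\gamma_0)S_{2,2}+S_{2,1}$; if $W=S_{1,2}$, solve $L(W,S_2)$ and return the result. **Theorem.** Let $m$ be an odd integer with $0<m<p$, and let $m_1,m_2,n_1,n_2$ be integers, none divisible by $p$, such that $m_1+m_2=n_1+n_2=m$,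 $m_1\not\equiv m_2$ and $n_1\not\equiv n_2 \pmod p$ (the conditions modulo $p$ hold automatically if $m_1,m_2,n_1,n_2$ are positive). For $i\in\{1,2\}$ let $h_i$ be the line $h_Q$ of the point $Q=m_1P+\varphi^i(m_2P)$ and $k_i$ the line $h_Q$ of the point $Q=n_1P+\varphi^i(n_2P)$, and assume that $h_1,h_2\notin\{k_1,k_2\}$ (a line that is undefined because its point is $P_\infty$ counts as different from all lines). Then the subalgorithm is correct: the polynomials computed in step 2, if $h_{m_1P}\neq h_{m_2P}$, respectively $h_{n_1P}\ne h_{n_2P}$, are $S_{m_1P,m_2P}$, respectively $S_{n_1P,n_2P}$; and, for every order of the factors in step 4, the subalgorithm does not fail and returns the line $h_{mP}$, which exists and is unique. -/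

import Mathlib

open Polynomial
open scoped Polynomial.Bivariate WeierstrassCurve.Affine

namespace TraceZero

noncomputable section

/-! ### The curve, the Frobenius endomorphism, and the trace-zero subgroup -/

/-- The cubic `f = x³ + A x + B`. -/
def cubic {F : Type*} [Field F] (A B : F) : F[X] := X ^ 3 + C A * X + C B

/-- The curve `y² = x³ + A x + B`. -/
def curve {F : Type*} [Field F] (A B : F) : WeierstrassCurve.Affine F :=
  { a₁ := 0, a₂ := 0, a₃ := 0, a₄ := A, a₆ := B }

section Points

variable {F L : Type*} [Field F] [Fintype F] [Field L] [Algebra F L] [DecidableEq L]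

/-- The Frobenius endomorphism `φ : (x, y) ↦ (x ^ q, y ^ q)` of `E(L)`, where `q = #F`. -/
def frob (A B : F) : ((curve A B)⁄L).Point →+ ((curve A B)⁄L).Point :=
  WeierstrassCurve.Affine.Point.map (FiniteField.frobeniusAlgHom F L)

/-- The kernel of the trace `P ↦ P + φ(P) + φ²(P)` on `E(L)`; this is the trace-zero subgroup `T₃`
when `L` has degree three over `F`. -/
def traceZero (L : Type*) [Field L] [Algebra F L] [DecidableEq L] (A B : F) :
    AddSubgroup ((curve A B)⁄L).Point :=
  AddMonoidHom.ker (AddMonoidHom.id ((curve A B)⁄L).Point + frob A B + (frob A B).comp (frob A B))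

end Points

/-! ### Lines -/

/-- The line `y - (slope * x + const) = 0`, given by its pair of coefficients. -/
@[ext]
structure Line (F : Type*) where
  slope : F
  const : F

/-- The polynomial `α₁ x + α₀` of the line `y - (α₁ x + α₀) = 0`. -/
def Line.rhs {F : Type*} [Field F] (h : Line F) : F[X] := C h.slope * X + C h.const

/-- From `h(x, y) = y - (α₁ x + α₀)` to `-h(x, -y) = y + (α₁ x + α₀)`. -/
def Line.neg {F : Type*} [Field F] (h : Line F) : Line F := ⟨-h.slope, -h.const⟩

section LineOf

variable {F L : Type*} [Field F] [Fintype F] [Field L] [Algebra F L] [DecidableEq L]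

/-- The (affine) point lies on the line. -/
def Line.Contains {A B : F} (h : Line F) : ((curve A B)⁄L).Point → Prop
  | .zero => False
  | .some x y _ => y = algebraMap F L h.slope * x + algebraMap F L h.const

/-- `h` is the line `h_Q` through `Q`, `φ(Q)`, `φ²(Q)`.  It never holds for `Q = P_∞`. -/
def IsLineOf {A B : F} (h : Line F) (Q : ((curve A B)⁄L).Point) : Prop :=
  h.Contains Q ∧ h.Contains (frob A B Q) ∧ h.Contains (frob A B (frob A B Q))

end LineOf

/-! ### The polynomials `S_{P,Q} = (S_{P,Q})₁ + y (S_{P,Q})₂` -/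

section Divisor

variable {F L : Type*} [Field F] [Fintype F] [Field L] [Algebra F L] [DecidableEq L]

/-- The prime ideal of the affine coordinate ring at an affine point, and the unit ideal at `P_∞`. -/
def pointIdeal {A B : F} : ((curve A B)⁄L).Point → Ideal ((curve A B)⁄L).CoordinateRing
  | .zero => ⊤
  | .some x y _ => WeierstrassCurve.Affine.CoordinateRing.XYIdeal ((curve A B)⁄L) x (C y)

/-- The function on the curve over `L` given by a polynomial `S.1 + y * S.2` over `F`. -/
def toFunction (L : Type*) [Field L] [Algebra F L] (A B : F) (S : F[X] × F[X]) :
    ((curve A B)⁄L).CoordinateRing :=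
  WeierstrassCurve.Affine.CoordinateRing.mk ((curve A B)⁄L)
    (C (S.1.map (algebraMap F L)) + Y * C (S.2.map (algebraMap F L)))

/-- `S = S.1 + y * S.2` is a polynomial `S_{P,Q}`: its divisor on the curve is
`∑_{0 ≤ i, j ≤ 2} (φⁱ(P) + φʲ(Q)) - 9 P_∞`.  Divisors of functions have degree zero, so that it is
enough to compare the zeros outside `P_∞`, which is an equality of ideals of the affine
coordinate ring. -/
def IsS {A B : F} (S : F[X] × F[X]) (P Q : ((curve A B)⁄L).Point) : Prop :=
  Ideal.span {toFunction L A B S} =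
    ∏ i : Fin 3, ∏ j : Fin 3,
      pointIdeal ((frob A B)^[(i : ℕ)] P + (frob A B)^[(j : ℕ)] Q)

end Divisor

section Formulas

/-! Explicit formulas for the coefficients of `S_{P,Q}`, up to a common factor, in terms of
`h_P = y - (α₁ x + α₀)` and `h_Q = y - (β₁ x + β₀)`. -/

variable {F : Type*} [Field F]

/-- The coefficient `a4` of `x^4`. -/
def sCoeffA4 (A B α₁ α₀ β₁ β₀ : F) : F :=
  -α₁^3 * β₁ * β₀^2 - 3 * B * α₁^3 * β₁ + 2 * A * α₁^3 * β₀ + 2 * α₁^2 * α₀ * β₁^2 * β₀ + A *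
    α₁^2 * α₀ * β₁ - 6 * B * α₁^2 * β₁^2 + 3 * A * α₁^2 * β₁ * β₀ + A^2 * α₁^2 - α₁ * α₀^2 *
    β₁^3 + 6 * α₁ * α₀^2 * β₀ + 3 * A * α₁ * α₀ * β₁^2 + 3 * α₁ * α₀ * β₀^2 + 9 * B * α₁ * α₀ -
    3 * B * α₁ * β₁^3 + A * α₁ * β₁^2 * β₀ + 2 * A^2 * α₁ * β₁ - 3 * α₁ * β₀^3 + 9 * B * α₁ * β₀
    - 3 * α₀^3 * β₁ + 3 * α₀^2 * β₁ * β₀ - 3 * A * α₀^2 + 2 * A * α₀ * β₁^3 + 6 * α₀ * β₁ * β₀^2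
    + 9 * B * α₀ * β₁ - 6 * A * α₀ * β₀ + A^2 * β₁^2 + 9 * B * β₁ * β₀ - 3 * A * β₀^2

/-- The coefficient `a3` of `x^3`. -/
def sCoeffA3 (A B α₁ α₀ β₁ β₀ : F) : F :=
  4 * B * α₁^3 * β₁^3 - 2 * A * α₁^3 * β₁^2 * β₀ + A^2 * α₁^3 * β₁ - α₁^3 * β₀^3 + 9 * B * α₁^3
    * β₀ - 2 * A * α₁^2 * α₀ * β₁^3 - α₁^2 * α₀ * β₁ * β₀^2 + 3 * B * α₁^2 * α₀ * β₁ - 7 * A *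
    α₁^2 * α₀ * β₀ + A^2 * α₁^2 * β₁^2 - 6 * B * α₁^2 * β₁ * β₀ + 3 * A * α₁^2 * β₀^2 + 6 * A *
    B * α₁^2 - α₁ * α₀^2 * β₁^2 * β₀ + A * α₁ * α₀^2 * β₁ - 6 * B * α₁ * α₀ * β₁^2 + 12 * A * α₁
    * α₀ * β₁ * β₀ - 8 * A^2 * α₁ * α₀ + A^2 * α₁ * β₁^3 + 3 * B * α₁ * β₁^2 * β₀ + A * α₁ * β₁
    * β₀^2 - 6 * A * B * α₁ * β₁ + 4 * A^2 * α₁ * β₀ - α₀^3 * β₁^3 - 3 * α₀^3 * β₀ + 3 * A *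
    α₀^2 * β₁^2 + 21 * α₀^2 * β₀^2 - 18 * B * α₀^2 + 9 * B * α₀ * β₁^3 - 7 * A * α₀ * β₁^2 * β₀
    + 4 * A^2 * α₀ * β₁ - 3 * α₀ * β₀^3 + 18 * B * α₀ * β₀ + 6 * A * B * β₁^2 - 8 * A^2 * β₁ *
    β₀ - 18 * B * β₀^2 + 4 * A^3 + 27 * B^2

/-- The coefficient `a2` of `x^2`. -/
def sCoeffA2 (A B α₁ α₀ β₁ β₀ : F) : F :=
  -A^2 * α₁^3 * β₁^3 - 2 * A * α₁^3 * β₁ * β₀^2 - 6 * A * B * α₁^3 * β₁ + A^2 * α₁^3 * β₀ - 2 *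
    A * α₁^2 * α₀ * β₁^2 * β₀ + 5 * A^2 * α₁^2 * α₀ * β₁ - 3 * α₁^2 * α₀ * β₀^3 - 9 * B * α₁^2 *
    α₀ * β₀ + 6 * A * B * α₁^2 * β₁^2 + 9 * B * α₁^2 * β₀^2 + (2 * A^3 + 27 * B^2) * α₁^2 - 2 *
    A * α₁ * α₀^2 * β₁^3 - 3 * α₁ * α₀^2 * β₁ * β₀^2 + 9 * B * α₁ * α₀^2 * β₁ + 9 * A * α₁ *
    α₀^2 * β₀ + 36 * B * α₁ * α₀ * β₁ * β₀ - 12 * A * α₁ * α₀ * β₀^2 - 18 * A * B * α₁ * α₀ - 6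
    * A * B * α₁ * β₁^3 + 5 * A^2 * α₁ * β₁^2 * β₀ + 9 * B * α₁ * β₁ * β₀^2 + (4 * A^3 - 27 *
    B^2) * α₁ * β₁ - 3 * A * α₁ * β₀^3 + 36 * A * B * α₁ * β₀ - 3 * α₀^3 * β₁^2 * β₀ - 3 * A *
    α₀^3 * β₁ + 9 * B * α₀^2 * β₁^2 - 12 * A * α₀^2 * β₁ * β₀ + 6 * A^2 * α₀^2 + A^2 * α₀ * β₁^3
    - 9 * B * α₀ * β₁^2 * β₀ + 9 * A * α₀ * β₁ * β₀^2 + 36 * A * B * α₀ * β₁ - 24 * A^2 * α₀ *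
    β₀ + (2 * A^3 + 27 * B^2) * β₁^2 - 18 * A * B * β₁ * β₀ + 6 * A^2 * β₀^2

/-- The coefficient `a1` of `x^1`. -/
def sCoeffA1 (A B α₁ α₀ β₁ β₀ : F) : F :=
  -A^2 * α₁^3 * β₁^2 * β₀ - 4 * B * α₁^3 * β₁ * β₀^2 + (A^3 - 12 * B^2) * α₁^3 * β₁ + 8 * A * B
    * α₁^3 * β₀ - A^2 * α₁^2 * α₀ * β₁^3 - 4 * B * α₁^2 * α₀ * β₁^2 * β₀ + 16 * A * B * α₁^2 *
    α₀ * β₁ - 3 * A^2 * α₁^2 * α₀ * β₀ + (-3 * A^3 + 12 * B^2) * α₁^2 * β₁^2 - 24 * A * B * α₁^2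
    * β₁ * β₀ + 3 * A^2 * α₁^2 * β₀^2 - 2 * A^2 * B * α₁^2 - 4 * B * α₁ * α₀^2 * β₁^3 - 3 * A^2
    * α₁ * α₀^2 * β₁ - 3 * α₁ * α₀^2 * β₀^3 + 15 * B * α₁ * α₀^2 * β₀ - 24 * A * B * α₁ * α₀ *
    β₁^2 + 12 * A^2 * α₁ * α₀ * β₁ * β₀ - 6 * B * α₁ * α₀ * β₀^2 - 18 * B^2 * α₁ * α₀ + (A^3 -
    12 * B^2) * α₁ * β₁^3 + 16 * A * B * α₁ * β₁^2 * β₀ - 3 * A^2 * α₁ * β₁ * β₀^2 + 14 * A^2 *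
    B * α₁ * β₁ - 3 * B * α₁ * β₀^3 + 63 * B^2 * α₁ * β₀ - 3 * α₀^3 * β₁ * β₀^2 - 3 * B * α₀^3 *
    β₁ - 3 * A * α₀^3 * β₀ + 3 * A^2 * α₀^2 * β₁^2 - 6 * B * α₀^2 * β₁ * β₀ + 9 * A * α₀^2 *
    β₀^2 + 6 * A * B * α₀^2 + 8 * A * B * α₀ * β₁^3 - 3 * A^2 * α₀ * β₁^2 * β₀ + 15 * B * α₀ *
    β₁ * β₀^2 + 63 * B^2 * α₀ * β₁ - 3 * A * α₀ * β₀^3 - 42 * A * B * α₀ * β₀ - 2 * A^2 * B *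
    β₁^2 - 18 * B^2 * β₁ * β₀ + 6 * A * B * β₀^2 + 4 * A^4 + 27 * A * B^2

/-- The coefficient `a0` of `x^0`. -/
def sCoeffA0 (A B α₁ α₀ β₁ β₀ : F) : F :=
  2 * A^2 * B * α₁^3 * β₁ - A^3 * α₁^3 * β₀ - A^2 * α₁^2 * α₀ * β₁^2 * β₀ - 4 * B * α₁^2 * α₀ *
    β₁ * β₀^2 + 12 * B^2 * α₁^2 * α₀ * β₁ - 4 * A * B * α₁^2 * α₀ * β₀ - 5 * A^2 * B * α₁^2 *
    β₁^2 + (A^3 - 24 * B^2) * α₁^2 * β₁ * β₀ + 6 * A * B * α₁^2 * β₀^2 + (A^4 + 6 * A * B^2) *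
    α₁^2 - 4 * B * α₁ * α₀^2 * β₁^2 * β₀ + 2 * A * α₁ * α₀^2 * β₁ * β₀^2 - 2 * A * B * α₁ * α₀^2
    * β₁ - A^2 * α₁ * α₀^2 * β₀ + (A^3 - 24 * B^2) * α₁ * α₀ * β₁^2 + 24 * A * B * α₁ * α₀ * β₁
    * β₀ - 3 * A^2 * α₁ * α₀ * β₀^2 + A^2 * B * α₁ * α₀ + 2 * A^2 * B * α₁ * β₁^3 + 12 * B^2 *
    α₁ * β₁^2 * β₀ - 2 * A * B * α₁ * β₁ * β₀^2 + (-2 * A^4 - 6 * A * B^2) * α₁ * β₁ - 5 * A^2 *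
    B * α₁ * β₀ - α₀^3 * β₀^3 - 3 * B * α₀^3 * β₀ + 6 * A * B * α₀^2 * β₁^2 - 3 * A^2 * α₀^2 *
    β₁ * β₀ + 3 * B * α₀^2 * β₀^2 + (A^3 + 9 * B^2) * α₀^2 - A^3 * α₀ * β₁^3 - 4 * A * B * α₀ *
    β₁^2 * β₀ - A^2 * α₀ * β₁ * β₀^2 - 5 * A^2 * B * α₀ * β₁ - 3 * B * α₀ * β₀^3 + (2 * A^3 - 9
    * B^2) * α₀ * β₀ + (A^4 + 6 * A * B^2) * β₁^2 + A^2 * B * β₁ * β₀ + (A^3 + 9 * B^2) * β₀^2 +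
    4 * A^3 * B + 27 * B^3

/-- The coefficient `b3` of `y x^3`. -/
def sCoeffB3 (A B α₁ α₀ β₁ β₀ : F) : F :=
  α₁^3 * β₀^2 - B * α₁^3 - 2 * α₁^2 * α₀ * β₁ * β₀ + A * α₁^2 * α₀ + α₁^2 * β₁ * β₀^2 - 3 * B *
    α₁^2 * β₁ + A * α₁^2 * β₀ + α₁ * α₀^2 * β₁^2 - 2 * α₁ * α₀ * β₁^2 * β₀ + 2 * A * α₁ * α₀ *
    β₁ - 3 * B * α₁ * β₁^2 + 2 * A * α₁ * β₁ * β₀ + α₀^3 + α₀^2 * β₁^3 + 3 * α₀^2 * β₀ + A * α₀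
    * β₁^2 + 3 * α₀ * β₀^2 - B * β₁^3 + A * β₁^2 * β₀ + β₀^3

/-- The coefficient `b2` of `y x^2`. -/
def sCoeffB2 (A B α₁ α₀ β₁ β₀ : F) : F :=
  A^2 * α₁^3 + 3 * α₁^2 * α₀ * β₀^2 + 9 * B * α₁^2 * α₀ + 3 * A^2 * α₁^2 * β₁ + 3 * α₁^2 * β₀^3
    + 9 * B * α₁^2 * β₀ - 6 * α₁ * α₀^2 * β₁ * β₀ - 3 * A * α₁ * α₀^2 - 6 * α₁ * α₀ * β₁ * β₀^2
    + 18 * B * α₁ * α₀ * β₁ - 6 * A * α₁ * α₀ * β₀ + 3 * A^2 * α₁ * β₁^2 + 18 * B * α₁ * β₁ * β₀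
    - 3 * A * α₁ * β₀^2 + 3 * α₀^3 * β₁^2 + 3 * α₀^2 * β₁^2 * β₀ - 3 * A * α₀^2 * β₁ + 9 * B *
    α₀ * β₁^2 - 6 * A * α₀ * β₁ * β₀ + A^2 * β₁^3 + 9 * B * β₁^2 * β₀ - 3 * A * β₁ * β₀^2

/-- The coefficient `b1` of `y x^1`. -/
def sCoeffB1 (A B α₁ α₀ β₁ β₀ : F) : F :=
  -A^2 * α₁^3 * β₁^2 - 2 * A * α₁^3 * β₀^2 + 2 * A * B * α₁^3 - 12 * B * α₁^2 * α₀ * β₁^2 + 4 *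
    A * α₁^2 * α₀ * β₁ * β₀ - 3 * A^2 * α₁^2 * α₀ - A^2 * α₁^2 * β₁^3 - 12 * B * α₁^2 * β₁^2 *
    β₀ + 4 * A * α₁^2 * β₁ * β₀^2 + A^2 * α₁^2 * β₀ + 4 * A * α₁ * α₀^2 * β₁^2 - 3 * α₁ * α₀^2 *
    β₀^2 - 9 * B * α₁ * α₀^2 + 4 * A * α₁ * α₀ * β₁^2 * β₀ + 2 * A^2 * α₁ * α₀ * β₁ + 6 * α₁ *
    α₀ * β₀^3 + 18 * B * α₁ * α₀ * β₀ + 2 * A^2 * α₁ * β₁ * β₀ + 9 * B * α₁ * β₀^2 + (4 * A^3 +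
    27 * B^2) * α₁ + 6 * α₀^3 * β₁ * β₀ + A * α₀^3 - 2 * A * α₀^2 * β₁^3 - 3 * α₀^2 * β₁ * β₀^2
    + 9 * B * α₀^2 * β₁ - 9 * A * α₀^2 * β₀ + A^2 * α₀ * β₁^2 + 18 * B * α₀ * β₁ * β₀ - 9 * A *
    α₀ * β₀^2 + 2 * A * B * β₁^3 - 3 * A^2 * β₁^2 * β₀ - 9 * B * β₁ * β₀^2 + (4 * A^3 + 27 *
    B^2) * β₁ + A * β₀^3

/-- The coefficient `b0` of `y x^0`. -/
def sCoeffB0 (A B α₁ α₀ β₁ β₀ : F) : F :=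
  -2 * A^2 * α₁^3 * β₁ * β₀ - 8 * B * α₁^3 * β₀^2 + (A^3 + 8 * B^2) * α₁^3 + A^2 * α₁^2 * α₀ *
    β₁^2 - 8 * B * α₁^2 * α₀ * β₁ * β₀ + 6 * A * α₁^2 * α₀ * β₀^2 - 2 * A * B * α₁^2 * α₀ + A^2
    * α₁^2 * β₁^2 * β₀ + 4 * B * α₁^2 * β₁ * β₀^2 + (-A^3 - 12 * B^2) * α₁^2 * β₁ + 4 * A * B *
    α₁^2 * β₀ + 4 * B * α₁ * α₀^2 * β₁^2 + A^2 * α₁ * α₀^2 - 2 * A^2 * α₁ * α₀ * β₁^3 - 8 * B *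
    α₁ * α₀ * β₁^2 * β₀ + 8 * A * B * α₁ * α₀ * β₁ - 6 * A^2 * α₁ * α₀ * β₀ + (-A^3 - 12 * B^2)
    * α₁ * β₁^2 + 8 * A * B * α₁ * β₁ * β₀ - 3 * A^2 * α₁ * β₀^2 + 3 * α₀^3 * β₀^2 + B * α₀^3 -
    8 * B * α₀^2 * β₁^3 + 6 * A * α₀^2 * β₁^2 * β₀ - 3 * A^2 * α₀^2 * β₁ + 3 * α₀^2 * β₀^3 - 15
    * B * α₀^2 * β₀ + 4 * A * B * α₀ * β₁^2 - 6 * A^2 * α₀ * β₁ * β₀ - 15 * B * α₀ * β₀^2 + (4 *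
    A^3 + 27 * B^2) * α₀ + (A^3 + 8 * B^2) * β₁^3 - 2 * A * B * β₁^2 * β₀ + A^2 * β₁ * β₀^2 + B
    * β₀^3 + (4 * A^3 + 27 * B^2) * β₀

/-- `S_{P,Q}`, from the lines `h_P`, `h_Q`, by the explicit formulas. -/
def sRaw (A B : F) (h k : Line F) : F[X] × F[X] :=
  (C (sCoeffA4 A B h.slope h.const k.slope k.const) * X ^ 4
    + C (sCoeffA3 A B h.slope h.const k.slope k.const) * X ^ 3
    + C (sCoeffA2 A B h.slope h.const k.slope k.const) * X ^ 2
    + C (sCoeffA1 A B h.slope h.const k.slope k.const) * X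
    + C (sCoeffA0 A B h.slope h.const k.slope k.const),
   C (sCoeffB3 A B h.slope h.const k.slope k.const) * X ^ 3
    + C (sCoeffB2 A B h.slope h.const k.slope k.const) * X ^ 2
    + C (sCoeffB1 A B h.slope h.const k.slope k.const) * X
    + C (sCoeffB0 A B h.slope h.const k.slope k.const))

open Classical in
/-- `S_{P,Q}`, from the lines `h_P`, `h_Q`, scaled to `b₃ = 1` whenever `b₃ ≠ 0`. -/
def sPoly (A B : F) (h k : Line F) : F[X] × F[X] :=
  let S := sRaw A B h k
  if S.2.coeff 3 = 0 then S else (C (S.2.coeff 3)⁻¹ * S.1, C (S.2.coeff 3)⁻¹ * S.2)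

end Formulas

/-! ### The subalgorithm -/

section Algorithm

variable {F : Type*} [Field F]

/-- The norm `Σ = f S₂² - S₁²` of `S = S₁ + y S₂`. -/
def sigma (A B : F) (S : F[X] × F[X]) : F[X] := cubic A B * S.2 ^ 2 - S.1 ^ 2

/-- The monic scalar multiple of a nonzero polynomial. -/
def monicOf (g : F[X]) : F[X] := C g.leadingCoeff⁻¹ * g

/-- The augmented matrix `L(W, S)`, where `W = x³ + w₂ x² + w₁ x + w₀` and
`S = (a₄ x⁴ + a₃ x³ + a₂ x² + a₁ x + a₀) + y (x³ + b₂ x² + b₁ x + b₀)`. -/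
def linSys (W : F[X]) (S : F[X] × F[X]) : Matrix (Fin 3) (Fin 3) F :=
  let w := W.coeff
  let a := S.1.coeff
  let b := S.2.coeff
  !![w 0 * (w 2 - b 2), b 0 - w 0, w 0 * a 3 - a 4 * w 2 * w 0 - a 0;
     w 0 * (w 1 - b 1), b 0 * w 2 - w 0 * b 2, w 0 * a 2 - a 4 * w 1 * w 0 - a 0 * w 2;
     w 0 * (w 0 - b 0), b 0 * w 1 - b 1 * w 0, w 0 * a 1 - a 4 * w 0 ^ 2 - a 0 * w 1]

/-- `(γ₁, γ₀)` solves the linear system with the given augmented matrix. -/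
def Solves (M : Matrix (Fin 3) (Fin 3) F) (h : Line F) : Prop :=
  ∀ i, M i 0 * h.slope + M i 1 * h.const = M i 2

open Classical in
/-- Solve a linear system for the line `y - (γ₁ x + γ₀)`; fails unless there is exactly one
solution. -/
def solve (M : Matrix (Fin 3) (Fin 3) F) : Option (Line F) :=
  if e : ∃! h : Line F, Solves M h then some e.choose else none

open Classical in
/-- The monic distinct irreducible factors of degree three of `G`. -/
def cubicFactors (G : F[X]) : Finset F[X] :=
  (UniqueFactorizationMonoid.normalizedFactors G).toFinset.filter fun W => W.natDegree = 3

open Classical in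
/-- The `for` loop, over the list of the remaining cubic factors.  The result `none` means that a
linear system could not be solved uniquely or that the loop ended without returning a line. -/
def factorLoop (S₁ S₂ : F[X] × F[X]) : List F[X] → Option (Line F)
  | [] => none
  | W :: Ws =>
    if W ≠ S₁.2 then
      match solve (linSys W S₁) with
      | none => none
      | some h => if W ∣ h.rhs * S₂.2 + S₂.1 then some h else factorLoop S₁ S₂ Ws
    else
      solve (linSys W S₂)

open Classical in
/-- The subalgorithm.  The input lines are `h₁ = h_{m₁P}`, `h₂ = h_{m₂P}`, `k₁ = h_{n₁P}`,
`k₂ = h_{n₂P}`; `order` lists the cubic factors in the order in which the loop runs through them. -/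
def subalgorithm (A B : F) (order : Finset F[X] → List F[X]) (h₁ h₂ k₁ k₂ : Line F) :
    Option (Line F) :=
  if h₁ = h₂ then some h₁.neg
  else if k₁ = k₂ then some k₁.neg
  else
    let S₁ := sPoly A B h₁ h₂
    let S₂ := sPoly A B k₁ k₂
    if h₁ = h₂.neg then solve (linSys (monicOf S₁.1) S₂)
    else if k₁ = k₂.neg then solve (linSys (monicOf S₂.1) S₁)
    else
      let G := EuclideanDomain.gcd (sigma A B S₁) (sigma A B S₂)
      factorLoop S₁ S₂ (order (cubicFactors G))

end Algorithm

end

end TraceZero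

/-!
The nine chords through `-φⁱ(Q)` and `-φʲ(R)` meet the curve again at `φⁱ(Q) + φʲ(R)`. The product
of their equations, divided by the cubes of the lines of `-Q` and `-R`, is therefore a function with
the divisor of `S_{Q,R}`; eliminating the coordinates of the nine points by Vieta's formulas gives
the explicit coefficients.

Hence `S_{Q,R} = S₁ + y S₂` vanishes on the line of a point `Z` of trace zero if and only if `Z` is
one of the points `φⁱ(Q) + φʲ(R)`, and the irreducible factors of the norm `f S₂² - S₁²` are the
cubics `f - (α₁ x + α₀)²` of the lines `y = α₁ x + α₀` of these points. By the assumption on the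
lines, that of `mP` is the only one on which both `S_{m₁P,m₂P}` and `S_{n₁P,n₂P}` vanish. The system
`L(W, S)` says that `W` divides `(γ₁ x + γ₀) S₂ + S₁`, which determines the line as long as the
irreducible cubic `W` does not divide `S₂`. If it does, then `S` vanishes on the line as well as on
its negative, so that the other function cannot do the same, and its system has a unique solution.
-/

namespace TraceZero

noncomputable section

section Elimination

variable {R : Type*} [CommRing R] {A B x y α₁ α₀ β₁ β₀ : R} {z : Fin 3 → R}

/-- The equation of the chord through `(x₁, y₁)` and `(x₂, y₂)`, evaluated at `(x, y)`. -/
def chord (x₁ y₁ x₂ y₂ x y : R) : R := (x₂ - x₁) * (y - y₁) - (y₂ - y₁) * (x - x₁)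

/-- The `z i` are the abscissae, with multiplicity, of the intersection of `y = α₁ x + α₀` with
`y² = x³ + A x + B`, expressed by Vieta's formulas. -/
structure IsIntersection (A B α₁ α₀ : R) (z : Fin 3 → R) : Prop where
  sum_eq : z 0 + z 1 + z 2 = α₁ ^ 2
  sum_mul_eq : z 0 * z 1 + z 0 * z 2 + z 1 * z 2 = A - 2 * α₁ * α₀
  prod_eq : z 0 * z 1 * z 2 = α₀ ^ 2 - B

theorem IsIntersection.map {S : Type*} [CommRing S] (φ : R →+* S)
    (hz : IsIntersection A B α₁ α₀ z) :
    IsIntersection (φ A) (φ B) (φ α₁) (φ α₀) fun i => φ (z i) where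
  sum_eq := by simpa using congrArg φ hz.sum_eq
  sum_mul_eq := by simpa [map_ofNat] using congrArg φ hz.sum_mul_eq
  prod_eq := by simpa using congrArg φ hz.prod_eq

/-- The value of `y + α₁ x + α₀` at the third point of the curve on the chord through `(x, y)` and
`(u, w)`, cleared of the denominator `(u - x) ^ 3`. -/
def thirdPointValue (A α₁ α₀ x y u w : R) : R :=
  (y + α₁ * x + α₀) * (u - x) ^ 3
    + (w - y + α₁ * (u - x)) * ((3 * x ^ 2 + A) * (u - x) - 2 * y * (w - y))

theorem IsIntersection.prod_chord (hz : IsIntersection A B α₁ α₀ z) {u w : R}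
    (hxy : y ^ 2 = x ^ 3 + A * x + B) (huw : w ^ 2 = u ^ 3 + A * u + B) :
    ∏ i, chord (z i) (-(α₁ * z i + α₀)) u w x y =
      (y + α₁ * x + α₀) * (w + α₁ * u + α₀) * thirdPointValue A α₁ α₀ x y u w := by
  simp only [Fin.prod_univ_three, chord, thirdPointValue]
  set s := w - y + α₁ * (u - x)
  set g := y + α₁ * x + α₀
  linear_combination s ^ 3 * (hz.prod_eq - x * hz.sum_mul_eq + x ^ 2 * hz.sum_eq)
    + s ^ 2 * (u - x) * g * (hz.sum_mul_eq - 2 * x * hz.sum_eq)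
    + s * (u - x) ^ 2 * g ^ 2 * hz.sum_eq + s ^ 3 * hxy + s * g ^ 2 * (huw - hxy)

theorem prod_quadratic_eq {d : Fin 3 → R} {e₁ e₂ e₃ : R} (h₁ : d 0 + d 1 + d 2 = e₁)
    (h₂ : d 0 * d 1 + d 0 * d 2 + d 1 * d 2 = e₂) (h₃ : d 0 * d 1 * d 2 = e₃) (a b c : R) :
    ∏ j, (a * d j ^ 2 + b * d j + c) =
      c ^ 3 + c ^ 2 * b * e₁ + c ^ 2 * a * (e₁ ^ 2 - 2 * e₂) + c * b ^ 2 * e₂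
        + c * b * a * (e₁ * e₂ - 3 * e₃) + c * a ^ 2 * (e₂ ^ 2 - 2 * e₁ * e₃) + b ^ 3 * e₃
        + b ^ 2 * a * e₁ * e₃ + b * a ^ 2 * e₂ * e₃ + a ^ 3 * e₃ ^ 2 := by
  subst h₁ h₂ h₃
  rw [Fin.prod_univ_three]
  ring

theorem cube_eq_of_symmetric {d : Fin 3 → R} {e₁ e₂ e₃ : R} (h₁ : d 0 + d 1 + d 2 = e₁)
    (h₂ : d 0 * d 1 + d 0 * d 2 + d 1 * d 2 = e₂) (h₃ : d 0 * d 1 * d 2 = e₃) (j : Fin 3) :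
    d j ^ 3 = e₁ * d j ^ 2 - e₂ * d j + e₃ := by
  fin_cases j <;> simp only [Fin.mk_zero, Fin.mk_one, Fin.reduceFinMk]
  · linear_combination d 0 ^ 2 * h₁ - d 0 * h₂ + h₃
  · linear_combination d 1 ^ 2 * h₁ - d 1 * h₂ + h₃
  · linear_combination d 2 ^ 2 * h₁ - d 2 * h₂ + h₃

theorem IsIntersection.symmetric_sub (hz : IsIntersection A B α₁ α₀ z)
    (hxy : y ^ 2 = x ^ 3 + A * x + B) {g : R} (hg : g = y + α₁ * x + α₀) :
    (z 0 - x) + (z 1 - x) + (z 2 - x) = α₁ ^ 2 - 3 * x ∧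
    (z 0 - x) * (z 1 - x) + (z 0 - x) * (z 2 - x) + (z 1 - x) * (z 2 - x) =
      3 * x ^ 2 + A + 2 * y * α₁ - 2 * α₁ * g ∧
    (z 0 - x) * (z 1 - x) * (z 2 - x) = g * (g - 2 * y) := by
  subst hg
  refine ⟨?_, ?_, ?_⟩
  · linear_combination hz.sum_eq
  · linear_combination hz.sum_mul_eq - 2 * x * hz.sum_eq
  · linear_combination hz.prod_eq - x * hz.sum_mul_eq + x ^ 2 * hz.sum_eq + hxy

theorem IsIntersection.thirdPointValue_eq {u : Fin 3 → R} (hu : IsIntersection A B β₁ β₀ u)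
    (hxy : y ^ 2 = x ^ 3 + A * x + B) {f g m : R} (hf : f = y + α₁ * x + α₀)
    (hg : g = y + β₁ * x + β₀) (hm : m = 3 * x ^ 2 + A + 2 * y * β₁) (j : Fin 3) :
    thirdPointValue A α₁ α₀ x y (u j) (-(β₁ * u j + β₀)) =
      ((α₁ - β₁) * m + f * (β₁ ^ 2 - 3 * x)) * (u j - x) ^ 2
        + (g * (2 * y * (α₁ - β₁) - m) - f * (m - 2 * β₁ * g)) * (u j - x)
        + (f * (g * (g - 2 * y)) - 2 * y * g ^ 2) := by
  obtain ⟨h₁, h₂, h₃⟩ := hu.symmetric_sub hxy hg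
  have hcube := cube_eq_of_symmetric (d := fun j => u j - x) h₁ h₂ h₃ j
  subst hf hg hm
  unfold thirdPointValue
  linear_combination (y + α₁ * x + α₀) * hcube

theorem IsIntersection.equation (hz : IsIntersection A B α₁ α₀ z) (i : Fin 3) :
    (-(α₁ * z i + α₀)) ^ 2 = z i ^ 3 + A * z i + B := by
  linear_combination -cube_eq_of_symmetric hz.sum_eq hz.sum_mul_eq hz.prod_eq i

section Formulas

variable {F : Type*} [Field F] {A B : F} {h k : Line F} {u : Fin 3 → R} {φ : F →+* R}

theorem IsIntersection.prod_thirdPointValue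
    (hu : IsIntersection (φ A) (φ B) (φ k.slope) (φ k.const) u)
    (hxy : y ^ 2 = x ^ 3 + φ A * x + φ B) :
    ∏ j, thirdPointValue (φ A) (φ h.slope) (φ h.const) x y (u j)
        (-(φ k.slope * u j + φ k.const)) =
      -(y + φ k.slope * x + φ k.const) ^ 3 *
        ((sRaw A B h k).1.eval₂ φ x + y * (sRaw A B h k).2.eval₂ φ x) := by
  simp only [sRaw, sCoeffA4, sCoeffA3, sCoeffA2, sCoeffA1, sCoeffA0, sCoeffB3, sCoeffB2, sCoeffB1,
    sCoeffB0, map_add, map_sub, map_neg, map_mul, map_pow, map_ofNat, eval₂_add, eval₂_sub,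
    eval₂_neg, eval₂_mul, eval₂_pow, eval₂_ofNat, eval₂_C, eval₂_X]
  generalize φ A = A, φ B = B, φ h.slope = α₁, φ h.const = α₀, φ k.slope = β₁, φ k.const = β₀
    at *
  rw [Fintype.prod_congr _ _ (hu.thirdPointValue_eq hxy rfl rfl rfl)]
  obtain ⟨h₁, h₂, h₃⟩ := hu.symmetric_sub hxy rfl
  rw [prod_quadratic_eq (d := fun j => u j - x) h₁ h₂ h₃]
  obtain rfl : B = y ^ 2 - x ^ 3 - A * x := by linear_combination -hxy
  -- In terms of `g = y + β₁ x + β₀` and `f = y + α₁ x + α₀` the product is divisible by `g ^ 3`.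
  obtain ⟨g, rfl⟩ : ∃ g, β₀ = g - y - β₁ * x := ⟨y + β₁ * x + β₀, by ring⟩
  obtain ⟨f, rfl⟩ : ∃ f, α₀ = f - y - α₁ * x := ⟨y + α₁ * x + α₀, by ring⟩
  ring

theorem IsIntersection.prod_prod_chord
    (hz : IsIntersection (φ A) (φ B) (φ h.slope) (φ h.const) z)
    (hu : IsIntersection (φ A) (φ B) (φ k.slope) (φ k.const) u)
    (hxy : y ^ 2 = x ^ 3 + φ A * x + φ B) :
    ∏ j, ∏ i, chord (z i) (-(φ h.slope * z i + φ h.const)) (u j)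
        (-(φ k.slope * u j + φ k.const)) x y =
      -((y + φ h.slope * x + φ h.const) * (y + φ k.slope * x + φ k.const)) ^ 3 *
        (∏ j, (φ (h.slope - k.slope) * u j + φ (h.const - k.const))) *
        ((sRaw A B h k).1.eval₂ φ x + y * (sRaw A B h k).2.eval₂ φ x) := by
  have hval (j) : -(φ k.slope * u j + φ k.const) + φ h.slope * u j + φ h.const =
      φ (h.slope - k.slope) * u j + φ (h.const - k.const) := by
    simp only [map_sub]
    ring
  simp_rw [hz.prod_chord hxy (hu.equation _), hval, Finset.prod_mul_distrib,
    hu.prod_thirdPointValue hxy, Finset.prod_const, Finset.card_univ, Fintype.card_fin]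
  ring

end Formulas

end Elimination

section Frobenius

open WeierstrassCurve.Affine (Point)

theorem eq_zero_of_coprime_of_nsmul_eq_zero {G : Type*} [AddGroup G] {T : AddSubgroup G} {n : ℕ}
    (hT : (Nat.card T).Coprime n) {Q : G} (hQ : Q ∈ T) (h : n • Q = 0) : Q = 0 :=
  congrArg Subtype.val <| hT.nsmul_right_bijective.injective
    (a₁ := ⟨Q, hQ⟩) (a₂ := 0) (Subtype.ext (by simpa using h))

variable {F L : Type*} [Field F] [Field L] [Algebra F L] {A B : F}

theorem curve_equation_iff {x y : L} :
    ((curve A B)⁄L).Equation x y ↔ y ^ 2 = x ^ 3 + algebraMap F L A * x + algebraMap F L B := by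
  simp [WeierstrassCurve.Affine.equation_iff, curve]

theorem curve_negY (x y : L) : ((curve A B)⁄L).negY x y = -y := by
  simp [WeierstrassCurve.Affine.negY, curve]

theorem neg_some_eq {x y : L} (h : ((curve A B)⁄L).Nonsingular x y) :
    ∃ h', -Point.some x y h = .some x (-y) h' :=
  ⟨curve_negY (A := A) (B := B) x y ▸ (WeierstrassCurve.Affine.nonsingular_neg x y).2 h, by
    simp only [Point.neg_some, curve_negY]⟩

theorem collinear_of_add_add_eq_zero [DecidableEq L] {x₁ y₁ x₂ y₂ x₃ y₃ : L}
    {h₁ : ((curve A B)⁄L).Nonsingular x₁ y₁} {h₂ : ((curve A B)⁄L).Nonsingular x₂ y₂}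
    {h₃ : ((curve A B)⁄L).Nonsingular x₃ y₃} (hx : x₁ ≠ x₂)
    (hsum : Point.some x₁ y₁ h₁ + .some x₂ y₂ h₂ + .some x₃ y₃ h₃ = 0) :
    (y₁ - y₂) * (x₂ - x₃) = (y₂ - y₃) * (x₁ - x₂) := by
  rw [add_eq_zero_iff_neg_eq, Point.add_of_X_ne' hx, neg_neg] at hsum
  obtain ⟨hX, hY⟩ := Point.some.inj hsum
  rw [WeierstrassCurve.Affine.negAddY, hX, WeierstrassCurve.Affine.slope_of_X_ne hx,
    div_mul_eq_mul_div, div_add' _ _ _ (sub_ne_zero.2 hx), div_eq_iff (sub_ne_zero.2 hx)] at hY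
  linear_combination -hY

variable [Fintype F]

theorem exists_algebraMap_eq_of_pow_card_eq {x : L} (hx : x ^ Fintype.card F = x) :
    ∃ a : F, algebraMap F L a = x := by
  have hsplits : (X ^ Fintype.card F - X : F[X]).Splits := by
    simpa using (FiniteField.isSplittingField_sub F F).splits
  refine RingHom.mem_range.1 (hsplits.mem_range_of_isRoot
    (FiniteField.X_pow_card_sub_X_ne_zero F Fintype.one_lt_card) ?_)
  simp [hx]

/-- The slope and the intercept of the line through the conjugates are fixed by the Frobenius. -/
theorem exists_line_of_collinear_frobenius {φ : L →ₐ[F] L}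
    (hφ : φ = FiniteField.frobeniusAlgHom F L) {x y : L} (hx : φ x ≠ x)
    (hcol : (y - φ y) * (φ x - φ (φ x)) = (φ y - φ (φ y)) * (x - φ x)) :
    ∃ h : Line F, y = algebraMap F L h.slope * x + algebraMap F L h.const := by
  have hfix : ∀ z : L, φ z = z → ∃ a : F, algebraMap F L a = z := fun z hz =>
    exists_algebraMap_eq_of_pow_card_eq (by simpa [hφ] using hz)
  have hx₁ : x - φ x ≠ 0 := sub_ne_zero.2 hx.symm
  have hx₂ : φ x - φ (φ x) ≠ 0 := by rw [← map_sub]; exact (map_ne_zero φ).2 hx₁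
  obtain ⟨a, ha⟩ := hfix ((y - φ y) / (x - φ x)) (by
    rw [map_div₀, map_sub, map_sub, div_eq_div_iff hx₂ hx₁, hcol])
  have hslope : algebraMap F L a * (x - φ x) = y - φ y := by rw [ha, div_mul_cancel₀ _ hx₁]
  obtain ⟨b, hb⟩ := hfix (y - algebraMap F L a * x) (by
    rw [map_sub, map_mul, AlgHom.commutes]
    linear_combination hslope)
  exact ⟨⟨a, b⟩, by rw [hb, add_sub_cancel]⟩

variable [DecidableEq L] {h : Line F} {Q R : ((curve A B)⁄L).Point} {z : Fin 3 → L}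

theorem frob_some {x y : L} (h : ((curve A B)⁄L).Nonsingular x y) :
    ∃ h', frob A B (.some x y h) = .some (x ^ Fintype.card F) (y ^ Fintype.card F) h' :=
  ⟨_, rfl⟩

theorem frob_injective : Function.Injective (frob A B : ((curve A B)⁄L).Point →+ _) :=
  Point.map_injective _

theorem mem_traceZero : Q ∈ traceZero L A B ↔ Q + frob A B Q + frob A B (frob A B Q) = 0 := by
  simp [traceZero]

theorem frob_mem_traceZero (hQ : Q ∈ traceZero L A B) : frob A B Q ∈ traceZero L A B := by
  rw [mem_traceZero] at hQ ⊢
  rw [← map_add, ← map_add, hQ, map_zero]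

theorem iterate_frob_mem_traceZero (hQ : Q ∈ traceZero L A B) (n : ℕ) :
    (frob A B)^[n] Q ∈ traceZero L A B :=
  Function.Iterate.rec (· ∈ traceZero L A B) hQ (fun _ => frob_mem_traceZero) n

theorem frob_frob_eq (hQ : Q ∈ traceZero L A B) : frob A B (frob A B Q) = -(Q + frob A B Q) :=
  (neg_eq_of_add_eq_zero_right (mem_traceZero.1 hQ)).symm

theorem frob_frob_frob (hQ : Q ∈ traceZero L A B) : frob A B (frob A B (frob A B Q)) = Q := by
  rw [frob_frob_eq (frob_mem_traceZero hQ), frob_frob_eq hQ]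
  abel

theorem frob_ne_self (hT : (Nat.card (traceZero L A B)).Coprime 3) (hQ : Q ∈ traceZero L A B)
    (h0 : Q ≠ 0) : frob A B Q ≠ Q := fun e =>
  h0 <| eq_zero_of_coprime_of_nsmul_eq_zero hT hQ <| by
    have h := mem_traceZero.1 hQ
    rw [e, e] at h
    rw [← h]
    abel

theorem frob_ne_neg (hQ : Q ∈ traceZero L A B) (h0 : Q ≠ 0) : frob A B Q ≠ -Q := fun e =>
  h0 <| by simpa [e] using mem_traceZero.1 hQ

theorem frob_frob_ne_self (hT : (Nat.card (traceZero L A B)).Coprime 3)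
    (hQ : Q ∈ traceZero L A B) (h0 : Q ≠ 0) : frob A B (frob A B Q) ≠ Q := fun e =>
  frob_ne_self hT hQ h0 <| by rw [← congrArg (frob A B) e, frob_frob_frob hQ]

theorem frob_frob_ne_neg (hQ : Q ∈ traceZero L A B) (h0 : Q ≠ 0) :
    frob A B (frob A B Q) ≠ -Q := fun e =>
  h0 <| frob_injective <| by simpa [e] using mem_traceZero.1 hQ

theorem frob_ne_zero (h0 : Q ≠ 0) : frob A B Q ≠ 0 :=
  (map_ne_zero_iff _ frob_injective).2 h0

omit [Fintype F] [DecidableEq L] in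
theorem Line.Contains.exists_eq (hQ : h.Contains Q) :
    ∃ x hx, Q = .some x (algebraMap F L h.slope * x + algebraMap F L h.const) hx := by
  rcases Q with _ | ⟨x, y, hxy⟩
  · exact hQ.elim
  · obtain rfl : y = _ := hQ
    exact ⟨x, hxy, rfl⟩

omit [Fintype F] [DecidableEq L] in
theorem Line.Contains.neg (hQ : h.Contains Q) : h.neg.Contains (-Q) := by
  obtain ⟨x, hx, rfl⟩ := hQ.exists_eq
  obtain ⟨h', e⟩ := neg_some_eq hx
  rw [e]
  simp only [Line.Contains, Line.neg, map_neg]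
  ring

theorem Line.Contains.frob (hQ : h.Contains Q) : h.Contains (TraceZero.frob A B Q) := by
  obtain ⟨x, hx, rfl⟩ := hQ.exists_eq
  obtain ⟨h', e⟩ := frob_some hx
  rw [e]
  change FiniteField.frobeniusAlgHom F L (_ * x + _) =
    _ * FiniteField.frobeniusAlgHom F L x + _
  rw [map_add, map_mul, AlgHom.commutes, AlgHom.commutes]

theorem isLineOf_iff_contains : IsLineOf h Q ↔ h.Contains Q :=
  ⟨And.left, fun hQ => ⟨hQ, hQ.frob, hQ.frob.frob⟩⟩

theorem IsLineOf.ne_zero (hQ : IsLineOf h Q) : Q ≠ 0 := by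
  rintro rfl
  exact hQ.1

theorem IsLineOf.neg (hQ : IsLineOf h Q) : IsLineOf h.neg (-Q) :=
  isLineOf_iff_contains.2 hQ.1.neg

theorem IsLineOf.iterate_frob (hQ : IsLineOf h Q) (n : ℕ) : IsLineOf h ((frob A B)^[n] Q) :=
  Function.Iterate.rec (IsLineOf h) hQ (fun _ hh => isLineOf_iff_contains.2 hh.2.1) n

theorem isLineOf_frob_iff (hQ : Q ∈ traceZero L A B) :
    IsLineOf h (frob A B Q) ↔ IsLineOf h Q :=
  ⟨fun hh => frob_frob_frob hQ ▸ hh.iterate_frob 2, fun hh => hh.iterate_frob 1⟩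

theorem isLineOf_iterate_frob_iff (hQ : Q ∈ traceZero L A B) (n : ℕ) :
    IsLineOf h ((frob A B)^[n] Q) ↔ IsLineOf h Q := by
  induction n with
  | zero => rfl
  | succ n ih =>
    rw [Function.iterate_succ_apply', isLineOf_frob_iff (iterate_frob_mem_traceZero hQ n), ih]

/-- The three conjugates `φⁱ(Q)` are distinct points of the rational line `h`, and `z i` is the
abscissa of `φⁱ(Q)`. -/
structure LineOrbit (h : Line F) (Q : ((curve A B)⁄L).Point) (z : Fin 3 → L) : Prop where
  eq_some : ∀ i : Fin 3, ∃ hz, (frob A B)^[i] Q =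
    .some (z i) (algebraMap F L h.slope * z i + algebraMap F L h.const) hz
  injective : Function.Injective z

theorem IsLineOf.exists_lineOrbit (hT : (Nat.card (traceZero L A B)).Coprime 3)
    (hh : IsLineOf h Q) (hQ : Q ∈ traceZero L A B) : ∃ z, LineOrbit h Q z := by
  choose z hz hz' using fun i : Fin 3 => (hh.iterate_frob i).1.exists_eq
  have h0 := hh.ne_zero
  have hx {i j : Fin 3} (e : z i = z j) :
      (frob A B)^[i] Q = (frob A B)^[j] Q ∨ (frob A B)^[i] Q = -(frob A B)^[j] Q := by
    rw [hz' i, hz' j]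
    exact Point.X_eq_iff.1 e
  have h₁ : z 1 ≠ z 0 := fun e => (hx e).elim (frob_ne_self hT hQ h0) (frob_ne_neg hQ h0)
  have h₂ : z 2 ≠ z 0 := fun e =>
    (hx e).elim (frob_frob_ne_self hT hQ h0) (frob_frob_ne_neg hQ h0)
  have h₃ : z 2 ≠ z 1 := fun e => (hx e).elim
    (frob_ne_self hT (frob_mem_traceZero hQ) (frob_ne_zero h0))
    (frob_ne_neg (frob_mem_traceZero hQ) (frob_ne_zero h0))
  refine ⟨z, fun i => ⟨hz i, hz' i⟩, fun i j => ?_⟩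
  fin_cases i <;> fin_cases j <;> intro e <;>
    first | rfl | exact absurd e ‹_› | exact absurd e.symm ‹_›

theorem LineOrbit.isIntersection (hz : LineOrbit h Q z) :
    IsIntersection (algebraMap F L A) (algebraMap F L B)
      (algebraMap F L h.slope) (algebraMap F L h.const) z := by
  have e : ∀ i, (algebraMap F L h.slope * z i + algebraMap F L h.const) ^ 2 =
      z i ^ 3 + algebraMap F L A * z i + algebraMap F L B := fun i =>
    curve_equation_iff.1 (hz.eq_some i).1.1
  have hne {i j : Fin 3} (hij : i ≠ j) : z i - z j ≠ 0 := sub_ne_zero.2 (hz.injective.ne hij)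
  set a := algebraMap F L h.slope
  set b := algebraMap F L h.const
  have quadratic {i j : Fin 3} (hij : i ≠ j) :
      z i ^ 2 + z i * z j + z j ^ 2 + algebraMap F L A = a ^ 2 * (z i + z j) + 2 * a * b :=
    mul_left_cancel₀ (hne hij) (by linear_combination e j - e i)
  have h₁ : z 0 + z 1 + z 2 = a ^ 2 := mul_left_cancel₀ (hne (i := 1) (j := 2) (by decide)) (by
    linear_combination quadratic (i := 0) (j := 1) (by decide)
      - quadratic (i := 0) (j := 2) (by decide))
  have h₂ : z 0 * z 1 + z 0 * z 2 + z 1 * z 2 = algebraMap F L A - 2 * a * b := by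
    linear_combination (z 0 + z 1) * h₁ - quadratic (i := 0) (j := 1) (by decide)
  exact ⟨h₁, h₂, by linear_combination z 0 * h₂ - z 0 ^ 2 * h₁ - e 0⟩

theorem LineOrbit.exists_eq_iterate_of_contains (hz : LineOrbit h Q z) (hR : h.Contains R) :
    ∃ i : Fin 3, R = (frob A B)^[i] Q := by
  obtain ⟨x, hx, rfl⟩ := hR.exists_eq
  obtain ⟨h₁, h₂, h₃⟩ := hz.isIntersection
  have hprod : ∏ i, (x - z i) = 0 := by
    rw [Fin.prod_univ_three]
    linear_combination -curve_equation_iff.1 hx.1 - x ^ 2 * h₁ + x * h₂ - h₃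
  obtain ⟨i, -, hi⟩ := Finset.prod_eq_zero_iff.1 hprod
  obtain rfl : x = z i := sub_eq_zero.1 hi
  exact ⟨i, (hz.eq_some i).2.symm⟩

theorem LineOrbit.pow_card_ne (hz : LineOrbit h Q z) : z 0 ^ Fintype.card F ≠ z 0 := fun e => by
  obtain ⟨h₀, e₀⟩ := hz.eq_some 0
  obtain ⟨h₁, e₁⟩ := hz.eq_some 1
  obtain ⟨h₂, e₂⟩ := frob_some h₀
  have hφ : frob A B Q = _ := e₁
  rw [show Q = _ from e₀, e₂] at hφ
  exact zero_ne_one (hz.injective (e.symm.trans (Point.some.inj hφ).1))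

theorem LineOrbit.notMem_range (hz : LineOrbit h Q z) (a : F) : algebraMap F L a ≠ z 0 := fun e =>
  hz.pow_card_ne <| by rw [← e, ← map_pow, FiniteField.pow_card]

theorem LineOrbit.eq_of_contains (hz : LineOrbit h Q z) {h' : Line F} (hQ : h'.Contains Q) :
    h' = h := by
  obtain ⟨h₀, e₀⟩ := hz.eq_some 0
  rw [show Q = _ from e₀] at hQ
  have hQ : algebraMap F L h.slope * z 0 + algebraMap F L h.const =
    algebraMap F L h'.slope * z 0 + algebraMap F L h'.const := hQ
  by_cases hs : h'.slope = h.slope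
  · rw [hs] at hQ
    exact Line.ext hs ((algebraMap F L).injective (add_left_cancel hQ)).symm
  · refine absurd ?_ (hz.notMem_range ((h.const - h'.const) / (h'.slope - h.slope)))
    have : algebraMap F L h'.slope - algebraMap F L h.slope ≠ 0 :=
      sub_ne_zero.2 ((algebraMap F L).injective.ne hs)
    rw [map_div₀, map_sub, map_sub, div_eq_iff this]
    linear_combination hQ

theorem IsLineOf.unique (hT : (Nat.card (traceZero L A B)).Coprime 3) (hQ : Q ∈ traceZero L A B)
    {h' : Line F} (hh : IsLineOf h Q) (hh' : IsLineOf h' Q) : h' = h :=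
  let ⟨_, hz⟩ := hh.exists_lineOrbit hT hQ
  hz.eq_of_contains hh'.1

theorem exists_isLineOf (hT : (Nat.card (traceZero L A B)).Coprime 3)
    (hQ : Q ∈ traceZero L A B) (h0 : Q ≠ 0) : ∃ h : Line F, IsLineOf h Q := by
  have hne := frob_ne_self hT hQ h0
  have hne' := frob_ne_neg hQ h0
  have hsum := mem_traceZero.1 hQ
  rcases Q with _ | ⟨x, y, hxy⟩
  · exact absurd rfl h0
  obtain ⟨hxy', e⟩ := frob_some hxy
  obtain ⟨hxy'', e'⟩ := frob_some hxy'
  rw [e] at hne hne' hsum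
  rw [e'] at hsum
  have hx : x ^ Fintype.card F ≠ x := fun e => (Point.X_eq_iff.1 e).elim hne hne'
  obtain ⟨h, hh⟩ := exists_line_of_collinear_frobenius rfl hx
    (collinear_of_add_add_eq_zero hx.symm hsum)
  exact ⟨h, isLineOf_iff_contains.2 hh⟩

end Frobenius

section CoordinateRing

open WeierstrassCurve.Affine (CoordinateRing Point)
open WeierstrassCurve.Affine.CoordinateRing

variable {F L : Type*} [Field F] [Field L] [Algebra F L] {A B : F}

/-- The constant functions on the curve. -/
def coordC (A B : F) (L : Type*) [Field L] [Algebra F L] : L →+* CoordinateRing ((curve A B)⁄L) :=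
  (mk ((curve A B)⁄L)).comp (C.comp C)

/-- The function `x` on the curve. -/
def coordX (A B : F) (L : Type*) [Field L] [Algebra F L] : CoordinateRing ((curve A B)⁄L) :=
  mk ((curve A B)⁄L) (C X)

/-- The function `y` on the curve. -/
def coordY (A B : F) (L : Type*) [Field L] [Algebra F L] : CoordinateRing ((curve A B)⁄L) :=
  mk ((curve A B)⁄L) Y

theorem coordY_sq : coordY A B L ^ 2 = coordX A B L ^ 3 +
    coordC A B L (algebraMap F L A) * coordX A B L + coordC A B L (algebraMap F L B) := by
  simp only [coordY, coordX, coordC, RingHom.comp_apply, ← map_pow, ← map_mul, ← map_add]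
  refine AdjoinRoot.mk_eq_mk.2 ⟨1, ?_⟩
  simp [WeierstrassCurve.Affine.polynomial, curve]

theorem isUnit_coordC {a : L} (ha : a ≠ 0) : IsUnit (coordC A B L a) :=
  (isUnit_iff_ne_zero.2 ha).map _

theorem toFunction_eq (S : F[X] × F[X]) : toFunction L A B S =
    S.1.eval₂ ((coordC A B L).comp (algebraMap F L)) (coordX A B L) +
      coordY A B L * S.2.eval₂ ((coordC A B L).comp (algebraMap F L)) (coordX A B L) := by
  have h (p : F[X]) : mk ((curve A B)⁄L) (C (p.map (algebraMap F L))) =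
      p.eval₂ ((coordC A B L).comp (algebraMap F L)) (coordX A B L) := by
    have := hom_eval₂ (p.map (algebraMap F L)) C ((mk ((curve A B)⁄L)).comp C) X
    rwa [eval₂_C_X, eval₂_map] at this
  rw [toFunction, map_add, map_mul, h, h]
  rfl

theorem toFunction_C_mul (S : F[X] × F[X]) (a : F) :
    toFunction L A B (C a * S.1, C a * S.2) =
      coordC A B L (algebraMap F L a) * toFunction L A B S := by
  simp only [toFunction_eq, eval₂_mul, eval₂_C, RingHom.comp_apply]
  ring

theorem XClass_eq (x : L) :
    XClass ((curve A B)⁄L) x = coordX A B L - coordC A B L x := by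
  simp [XClass, coordX, coordC]

theorem YClass_linePolynomial (x y l : L) :
    YClass ((curve A B)⁄L) (WeierstrassCurve.Affine.linePolynomial x y l) =
      coordY A B L - (coordC A B L l * (coordX A B L - coordC A B L x) + coordC A B L y) := by
  simp [YClass, coordX, coordC, coordY, WeierstrassCurve.Affine.linePolynomial]

theorem pointIdeal_neg_mul {x y : L} (h : ((curve A B)⁄L).Nonsingular x y) :
    pointIdeal (-Point.some x y h) * pointIdeal (.some x y h) = XIdeal ((curve A B)⁄L) x :=
  XYIdeal_neg_mul h

theorem pointIdeal_ne_bot (Q : ((curve A B)⁄L).Point) : pointIdeal Q ≠ ⊥ := by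
  rcases Q with _ | ⟨x, y, hxy⟩
  · exact top_ne_bot
  · exact fun e => XClass_ne_zero (W' := (curve A B)⁄L) x <|
      Ideal.span_eq_bot.1 e _ (Set.mem_insert _ _)

theorem yIdeal_linePolynomial [DecidableEq L] {x₁ y₁ x₂ y₂ : L}
    (h₁ : ((curve A B)⁄L).Nonsingular x₁ y₁) (h₂ : ((curve A B)⁄L).Nonsingular x₂ y₂)
    (hxy : ¬(x₁ = x₂ ∧ y₁ = ((curve A B)⁄L).negY x₂ y₂)) :
    YIdeal ((curve A B)⁄L) (WeierstrassCurve.Affine.linePolynomial x₁ y₁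
        (((curve A B)⁄L).slope x₁ x₂ y₁ y₂)) =
      pointIdeal (.some x₁ y₁ h₁) * pointIdeal (.some x₂ y₂ h₂) *
        pointIdeal (-(.some x₁ y₁ h₁ + .some x₂ y₂ h₂)) := by
  have key := XYIdeal_mul_XYIdeal h₁.1 h₂.1 hxy
  have hneg := pointIdeal_neg_mul (WeierstrassCurve.Affine.nonsingular_add h₁ h₂ hxy)
  refine (Ideal.span_singleton_mul_right_inj (XClass_ne_zero (((curve A B)⁄L).addX x₁ x₂
    (((curve A B)⁄L).slope x₁ x₂ y₁ y₂)))).1 ?_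
  change XIdeal _ _ * _ = XIdeal _ _ * (XYIdeal _ _ _ * XYIdeal _ _ _ * _)
  rw [← mul_assoc, key, mul_assoc, Point.add_some hxy, mul_comm, ← hneg,
    mul_comm (pointIdeal (-_))]
  rfl

theorem span_chord_of_X_eq {x y₁ y₂ : L} (h₁ : ((curve A B)⁄L).Nonsingular x y₁) (hy : y₁ ≠ y₂) :
    Ideal.span {chord (coordC A B L x) (coordC A B L y₁) (coordC A B L x) (coordC A B L y₂)
        (coordX A B L) (coordY A B L)} =
      pointIdeal (-Point.some x y₁ h₁) * pointIdeal (.some x y₁ h₁) := by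
  have hchord : chord (coordC A B L x) (coordC A B L y₁) (coordC A B L x) (coordC A B L y₂)
      (coordX A B L) (coordY A B L) = coordC A B L (y₁ - y₂) * XClass ((curve A B)⁄L) x := by
    rw [chord, XClass_eq, map_sub]
    ring
  rw [pointIdeal_neg_mul, hchord,
    Ideal.span_singleton_mul_left_unit (isUnit_coordC (sub_ne_zero.2 hy))]
  rfl

theorem span_chord_of_X_ne [DecidableEq L] {x₁ y₁ x₂ y₂ : L} (hx : x₁ ≠ x₂) :
    Ideal.span {chord (coordC A B L x₁) (coordC A B L y₁) (coordC A B L x₂) (coordC A B L y₂)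
        (coordX A B L) (coordY A B L)} =
      YIdeal ((curve A B)⁄L) (WeierstrassCurve.Affine.linePolynomial x₁ y₁
        (((curve A B)⁄L).slope x₁ x₂ y₁ y₂)) := by
  have hslope : (x₂ - x₁) * ((curve A B)⁄L).slope x₁ x₂ y₁ y₂ = y₂ - y₁ := by
    rw [WeierstrassCurve.Affine.slope_of_X_ne hx, mul_div_assoc',
      div_eq_iff (sub_ne_zero.2 hx)]
    ring
  have hchord : chord (coordC A B L x₁) (coordC A B L y₁) (coordC A B L x₂) (coordC A B L y₂)
      (coordX A B L) (coordY A B L) = coordC A B L (x₂ - x₁) * YClass ((curve A B)⁄L)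
        (WeierstrassCurve.Affine.linePolynomial x₁ y₁ (((curve A B)⁄L).slope x₁ x₂ y₁ y₂)) := by
    rw [YClass_linePolynomial, chord, ← map_sub, ← map_sub, ← hslope, map_mul]
    ring
  rw [hchord, Ideal.span_singleton_mul_left_unit (isUnit_coordC (sub_ne_zero.2 hx.symm))]
  rfl

theorem span_chord [DecidableEq L] {x₁ y₁ x₂ y₂ : L} (h₁ : ((curve A B)⁄L).Nonsingular x₁ y₁)
    (h₂ : ((curve A B)⁄L).Nonsingular x₂ y₂) (hne : Point.some x₁ y₁ h₁ ≠ .some x₂ y₂ h₂) :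
    Ideal.span {chord (coordC A B L x₁) (coordC A B L y₁) (coordC A B L x₂) (coordC A B L y₂)
        (coordX A B L) (coordY A B L)} =
      pointIdeal (.some x₁ y₁ h₁) * pointIdeal (.some x₂ y₂ h₂) *
        pointIdeal (-(.some x₁ y₁ h₁ + .some x₂ y₂ h₂)) := by
  by_cases hx : x₁ = x₂
  · subst hx
    have hy : y₁ ≠ y₂ := fun e => hne (by simp only [e])
    have hneg : Point.some x₁ y₂ h₂ = -.some x₁ y₁ h₁ :=
      neg_eq_iff_eq_neg.1 ((Point.X_eq_iff.1 rfl).resolve_left hne).symm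
    rw [span_chord_of_X_eq h₁ hy, hneg, add_neg_cancel, neg_zero, mul_comm (pointIdeal (-_))]
    exact (Ideal.mul_top _).symm
  · rw [span_chord_of_X_ne hx, yIdeal_linePolynomial h₁ h₂ fun e => hx e.1]

/-- The function `y - (α₁ x + α₀)` on the curve over `L`. -/
def Line.toFunction (A B : F) (L : Type*) [Field L] [Algebra F L] (h : Line F) :
    CoordinateRing ((curve A B)⁄L) :=
  coordY A B L - (coordC A B L (algebraMap F L h.slope) * coordX A B L +
    coordC A B L (algebraMap F L h.const))

theorem Line.YClass_rhs (h : Line F) :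
    YClass ((curve A B)⁄L) (h.rhs.map (algebraMap F L)) = h.toFunction A B L := by
  simp [YClass, Line.rhs, Line.toFunction, coordX, coordY, coordC]

theorem Line.toFunction_ne_zero (h : Line F) : h.toFunction A B L ≠ 0 :=
  h.YClass_rhs (A := A) (B := B) (L := L) ▸ YClass_ne_zero _

theorem Line.neg_neg (h : Line F) : h.neg.neg = h :=
  Line.ext (_root_.neg_neg _) (_root_.neg_neg _)

theorem Line.toFunction_neg (h : Line F) : h.neg.toFunction A B L =
    coordY A B L + coordC A B L (algebraMap F L h.slope) * coordX A B L +
      coordC A B L (algebraMap F L h.const) := by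
  simp only [Line.toFunction, Line.neg, map_neg]
  ring

/-- The chords join `-φⁱ(Q)` and `-φʲ(R)`, hence meet the curve again at `φⁱ(Q) + φʲ(R)`. -/
theorem prod_prod_chord_eq {h k : Line F} {z u : Fin 3 → L}
    (hz : IsIntersection (algebraMap F L A) (algebraMap F L B) (algebraMap F L h.slope)
      (algebraMap F L h.const) z)
    (hu : IsIntersection (algebraMap F L A) (algebraMap F L B) (algebraMap F L k.slope)
      (algebraMap F L k.const) u) :
    ∏ j, ∏ i, chord (coordC A B L (z i))
        (coordC A B L (algebraMap F L h.neg.slope * z i + algebraMap F L h.neg.const))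
        (coordC A B L (u j))
        (coordC A B L (algebraMap F L k.neg.slope * u j + algebraMap F L k.neg.const))
        (coordX A B L) (coordY A B L) =
      -(h.neg.toFunction A B L * k.neg.toFunction A B L) ^ 3 *
        coordC A B L (∏ j, (algebraMap F L (h.slope - k.slope) * u j +
          algebraMap F L (h.const - k.const))) *
        toFunction L A B (sRaw A B h k) := by
  have key := IsIntersection.prod_prod_chord (φ := (coordC A B L).comp (algebraMap F L))
    (hz.map (coordC A B L)) (hu.map (coordC A B L)) coordY_sq
  simp only [RingHom.comp_apply] at key
  rw [Line.toFunction_neg, Line.toFunction_neg, toFunction_eq]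
  simp only [map_prod, map_add, map_mul, Line.neg, map_neg, neg_mul, ← neg_add] at key ⊢
  exact key

end CoordinateRing

section Divisor

open WeierstrassCurve.Affine (CoordinateRing Point)

variable {F L : Type*} [Field F] [Fintype F] [Field L] [Algebra F L] [DecidableEq L] {A B : F}
  {h k : Line F} {Q R : ((curve A B)⁄L).Point} {z u : Fin 3 → L}

theorem LineOrbit.span_toFunction (hz : LineOrbit h Q z) (hQ : Q ∈ traceZero L A B) :
    Ideal.span {h.toFunction A B L} = ∏ i : Fin 3, pointIdeal ((frob A B)^[i] Q) := by
  obtain ⟨h₀, e₀⟩ := hz.eq_some 0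
  obtain ⟨h₁, e₁⟩ := hz.eq_some 1
  have hx : z 1 - z 0 ≠ 0 := sub_ne_zero.2 (hz.injective.ne one_ne_zero)
  have hne : Point.some _ _ h₀ ≠ .some _ _ h₁ := fun e =>
    hx (sub_eq_zero.2 (Point.some.inj e).1.symm)
  have e₂ : (frob A B)^[(2 : Fin 3)] Q =
      -((frob A B)^[(0 : Fin 3)] Q + (frob A B)^[(1 : Fin 3)] Q) := frob_frob_eq hQ
  rw [Fin.prod_univ_three, e₂, e₀, e₁, ← span_chord h₀ h₁ hne,
    ← Ideal.span_singleton_mul_left_unit (isUnit_coordC (A := A) (B := B) hx)]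
  congr 2
  simp only [Line.toFunction, chord, map_sub, map_add, map_mul]
  ring

theorem LineOrbit.neg (hz : LineOrbit h Q z) : LineOrbit h.neg (-Q) z := by
  refine ⟨fun i => ?_, hz.injective⟩
  obtain ⟨h₀, e₀⟩ := hz.eq_some i
  obtain ⟨h₁, e₁⟩ := neg_some_eq h₀
  have hy : algebraMap F L h.neg.slope * z i + algebraMap F L h.neg.const =
      -(algebraMap F L h.slope * z i + algebraMap F L h.const) := by
    simp only [Line.neg, map_neg]
    ring
  rw [iterate_map_neg, e₀, e₁, hy]
  exact ⟨h₁, rfl⟩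

theorem LineOrbit.isLineOf (hz : LineOrbit h Q z) : IsLineOf h Q := by
  obtain ⟨h₀, e⟩ := hz.eq_some 0
  rw [isLineOf_iff_contains, show Q = _ from e]
  rfl

theorem LineOrbit.not_contains_iterate_frob (hu : LineOrbit k R u) (hR : R ∈ traceZero L A B)
    (hne : h ≠ k) (n : ℕ) : ¬h.Contains ((frob A B)^[n] R) := fun hh =>
  hne <| hu.eq_of_contains ((isLineOf_iterate_frob_iff hR n).1 (isLineOf_iff_contains.2 hh)).1

theorem LineOrbit.prod_ne_zero (hu : LineOrbit k R u) (hR : R ∈ traceZero L A B) (hne : h ≠ k) :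
    ∏ j, (algebraMap F L (h.slope - k.slope) * u j + algebraMap F L (h.const - k.const)) ≠ 0 := by
  refine Finset.prod_ne_zero_iff.2 fun j _ hj => hu.not_contains_iterate_frob hR hne j ?_
  rw [(hu.eq_some j).2]
  change algebraMap F L k.slope * u j + algebraMap F L k.const =
    algebraMap F L h.slope * u j + algebraMap F L h.const
  simp only [map_sub] at hj
  linear_combination -hj

theorem LineOrbit.span_chord (hz : LineOrbit h Q z) (hu : LineOrbit k R u)
    (hR : R ∈ traceZero L A B) (hne : h ≠ k) (i j : Fin 3) :
    Ideal.span {chord (coordC A B L (z i))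
        (coordC A B L (algebraMap F L h.slope * z i + algebraMap F L h.const)) (coordC A B L (u j))
        (coordC A B L (algebraMap F L k.slope * u j + algebraMap F L k.const))
        (coordX A B L) (coordY A B L)} =
      pointIdeal ((frob A B)^[i] Q) * pointIdeal ((frob A B)^[j] R) *
        pointIdeal (-((frob A B)^[i] Q + (frob A B)^[j] R)) := by
  obtain ⟨h₁, e₁⟩ := hz.eq_some i
  obtain ⟨h₂, e₂⟩ := hu.eq_some j
  have hPQ : (frob A B)^[i] Q ≠ (frob A B)^[j] R := fun e =>
    hu.not_contains_iterate_frob hR hne j (e ▸ (hz.isLineOf.iterate_frob i).1)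
  rw [e₁, e₂] at hPQ ⊢
  exact TraceZero.span_chord h₁ h₂ hPQ

theorem prod_pow_three {M : Type*} [CommMonoid M] (a b : Fin 3 → M) (c : Fin 3 → Fin 3 → M) :
    ∏ j, ∏ i, (a i * b j * c i j) = ((∏ i, a i) * ∏ j, b j) ^ 3 * ∏ i, ∏ j, c i j := by
  simp only [Finset.prod_mul_distrib, Finset.prod_const, Finset.card_univ, Fintype.card_fin]
  rw [mul_pow, Finset.prod_pow, Finset.prod_comm (f := fun j i => c i j)]

theorem LineOrbit.isS_sRaw (hz : LineOrbit h Q z) (hu : LineOrbit k R u)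
    (hQ : Q ∈ traceZero L A B) (hR : R ∈ traceZero L A B) (hne : h ≠ k) :
    IsS (sRaw A B h k) Q R := by
  have hne' : h.neg ≠ k.neg := fun e => hne (by rw [← h.neg_neg, e, k.neg_neg])
  have hchord (i j : Fin 3) :=
    hz.neg.span_chord hu.neg (neg_mem hR) hne' i j
  simp only [iterate_map_neg (frob A B : ((curve A B)⁄L).Point →+ _), ← neg_add,
    neg_neg] at hchord
  have hQ' := hz.neg.span_toFunction (neg_mem hQ)
  have hR' := hu.neg.span_toFunction (neg_mem hR)
  simp only [iterate_map_neg (frob A B : ((curve A B)⁄L).Point →+ _)] at hQ' hR'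
  have key := congrArg (fun f => Ideal.span {f})
    (prod_prod_chord_eq hz.isIntersection hu.isIntersection)
  simp only [← Ideal.prod_span_singleton, hchord, prod_pow_three] at key
  rw [← hQ', ← hR', Ideal.span_singleton_mul_span_singleton, Ideal.span_singleton_pow,
    ← Ideal.span_singleton_neg, mul_assoc, ← Ideal.span_singleton_mul_span_singleton,
    Ideal.span_singleton_mul_left_unit (isUnit_coordC (hu.prod_ne_zero hR hne))] at key
  refine ((Ideal.span_singleton_mul_right_inj ?_).1 key).symm
  exact neg_ne_zero.2 (pow_ne_zero _
    (mul_ne_zero h.neg.toFunction_ne_zero k.neg.toFunction_ne_zero))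

theorem IsLineOf.isS_sPoly (hT : (Nat.card (traceZero L A B)).Coprime 3) (hh : IsLineOf h Q)
    (hk : IsLineOf k R) (hQ : Q ∈ traceZero L A B) (hR : R ∈ traceZero L A B) (hne : h ≠ k) :
    IsS (sPoly A B h k) Q R := by
  obtain ⟨z, hz⟩ := hh.exists_lineOrbit hT hQ
  obtain ⟨u, hu⟩ := hk.exists_lineOrbit hT hR
  have key := hz.isS_sRaw hu hQ hR hne
  rw [sPoly]
  split_ifs with hb
  · exact key
  · rwa [IsS, toFunction_C_mul, Ideal.span_singleton_mul_left_unit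
      (isUnit_coordC ((_root_.map_ne_zero _).2 (inv_ne_zero hb)))]

theorem IsS.ne_zero {S : F[X] × F[X]} (hS : IsS S Q R) : S ≠ 0 := by
  rintro rfl
  have h0 : toFunction L A B 0 = 0 := by simp [toFunction]
  rw [IsS, h0, Ideal.span_singleton_zero, ← Ideal.zero_eq_bot] at hS
  exact Finset.prod_ne_zero_iff.2 (fun i _ => Finset.prod_ne_zero_iff.2
    fun j _ => pointIdeal_ne_bot _) hS.symm

end Divisor

section Zeros

open WeierstrassCurve.Affine (CoordinateRing Point)
open WeierstrassCurve.Affine.CoordinateRing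

variable {F L K : Type*} [Field F] [Field L] [Algebra F L] [Field K] [Algebra L K] [Algebra F K]
  [IsScalarTower F L K] {A B : F} {x y : K}

/-- Evaluation of functions on the curve at a point `(x, y)` over an extension `K` of `L`. -/
def evalAt (L : Type*) [Field L] [Algebra F L] [Algebra L K] [IsScalarTower F L K]
    (hxy : y ^ 2 = x ^ 3 + algebraMap F K A * x + algebraMap F K B) :
    CoordinateRing ((curve A B)⁄L) →+* K :=
  AdjoinRoot.lift (eval₂RingHom (algebraMap L K) x) y <| by
    simp [WeierstrassCurve.Affine.polynomial, curve, ← IsScalarTower.algebraMap_apply, hxy,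
      eval₂_pow]

variable (hxy : y ^ 2 = x ^ 3 + algebraMap F K A * x + algebraMap F K B)

theorem evalAt_coordC (a : L) : evalAt L hxy (coordC A B L a) = algebraMap L K a := by
  simp [evalAt, coordC]

theorem evalAt_coordX : evalAt L hxy (coordX A B L) = x := by
  simp [evalAt, coordX]

theorem evalAt_coordY : evalAt L hxy (coordY A B L) = y := by
  simp [evalAt, coordY]

theorem evalAt_toFunction (S : F[X] × F[X]) :
    evalAt L hxy (toFunction L A B S) = aeval x S.1 + y * aeval x S.2 := by
  have h : ((evalAt L hxy).comp ((coordC A B L).comp (algebraMap F L))) = algebraMap F K := by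
    ext a
    simp only [RingHom.comp_apply, evalAt_coordC, ← IsScalarTower.algebraMap_apply]
  rw [toFunction_eq, map_add, map_mul, hom_eval₂, hom_eval₂, evalAt_coordX, evalAt_coordY, h]
  rfl

theorem map_evalAt_pointIdeal_eq_bot_iff {R : ((curve A B)⁄L).Point} :
    (pointIdeal R).map (evalAt L hxy) = ⊥ ↔
      ∃ x' y' h', R = .some x' y' h' ∧ algebraMap L K x' = x ∧ algebraMap L K y' = y := by
  rcases R with _ | ⟨x', y', h'⟩
  · rw [show pointIdeal (.zero : ((curve A B)⁄L).Point) = ⊤ from rfl, Ideal.map_top]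
    exact iff_of_false top_ne_bot (by rintro ⟨_, _, _, ⟨⟩, _⟩)
  · have hY : YClass ((curve A B)⁄L) (C y') = coordY A B L - coordC A B L y' := by
      simp [YClass, coordY, coordC]
    rw [pointIdeal, XYIdeal, Ideal.map_span, Ideal.span_eq_bot, Set.image_pair, XClass_eq, hY]
    simp only [map_sub, evalAt_coordC, evalAt_coordX, evalAt_coordY, Set.forall_mem_insert,
      Set.mem_singleton_iff, forall_eq, sub_eq_zero]
    constructor
    · rintro ⟨rfl, rfl⟩
      exact ⟨x', y', h', rfl, rfl, rfl⟩
    · rintro ⟨x'', y'', h'', e, rfl, rfl⟩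
      obtain ⟨rfl, rfl⟩ := Point.some.inj e
      exact ⟨rfl, rfl⟩

theorem IsS.eval_eq_zero_iff [Fintype F] [DecidableEq L] {S : F[X] × F[X]}
    {P Q : ((curve A B)⁄L).Point} (hS : IsS S P Q)
    (hxy : y ^ 2 = x ^ 3 + algebraMap F K A * x + algebraMap F K B) :
    aeval x S.1 + y * aeval x S.2 = 0 ↔ ∃ i j : Fin 3, ∃ x' y' h',
      (frob A B)^[i] P + (frob A B)^[j] Q = .some x' y' h' ∧
        algebraMap L K x' = x ∧ algebraMap L K y' = y := by
  have key := congrArg (Ideal.mapHom (evalAt L hxy)) hS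
  simp only [map_prod, Ideal.mapHom_apply, Ideal.map_span, Set.image_singleton,
    evalAt_toFunction] at key
  rw [← Ideal.span_singleton_eq_bot, key, ← Ideal.zero_eq_bot]
  simp only [Finset.prod_eq_zero_iff, Finset.mem_univ, true_and]
  simp only [Ideal.zero_eq_bot, map_evalAt_pointIdeal_eq_bot_iff]

end Zeros

section Cubic

variable {F : Type*} [Field F] {A B : F}

/-- The monic cubic whose roots are the abscissae of the intersection of the curve with a line. -/
def Line.cubic (A B : F) (h : Line F) : F[X] := TraceZero.cubic A B - h.rhs ^ 2

/-- The function `S = S₁ + y S₂` vanishes on the intersection of the curve with the line `h`. -/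
def VanishesOn (A B : F) (S : F[X] × F[X]) (h : Line F) : Prop :=
  h.cubic A B ∣ h.rhs * S.2 + S.1

theorem Line.rhs_neg (h : Line F) : h.neg.rhs = -h.rhs := by
  simp only [Line.neg, Line.rhs, C_neg]
  ring

theorem Line.cubic_neg (h : Line F) : h.neg.cubic A B = h.cubic A B := by
  rw [Line.cubic, h.rhs_neg, neg_sq, Line.cubic]

theorem Line.cubic_eq (h : Line F) : h.cubic A B = X ^ 3 + (C (-h.slope ^ 2) * X ^ 2 +
    C (A - 2 * h.slope * h.const) * X + C (B - h.const ^ 2)) := by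
  simp only [Line.cubic, TraceZero.cubic, Line.rhs, C_sub, C_mul, C_neg, C_pow, C_ofNat]
  ring

theorem Line.monic_cubic (h : Line F) : (h.cubic A B).Monic := by
  rw [h.cubic_eq]
  exact monic_X_pow_add (by compute_degree!)

theorem Line.natDegree_cubic (h : Line F) : (h.cubic A B).natDegree = 3 := by
  rw [h.cubic_eq]
  compute_degree!

theorem vanishesOn_iff_of_dvd_snd {h : Line F} {S : F[X] × F[X]} (hS : h.cubic A B ∣ S.2) :
    VanishesOn A B S h ↔ h.cubic A B ∣ S.1 :=
  dvd_add_right (hS.mul_left _)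

theorem VanishesOn.neg {h : Line F} {S : F[X] × F[X]} (hh : VanishesOn A B S h)
    (hS : h.cubic A B ∣ S.2) : VanishesOn A B S h.neg := by
  rw [vanishesOn_iff_of_dvd_snd hS] at hh
  rw [← h.cubic_neg] at hh hS
  exact (vanishesOn_iff_of_dvd_snd hS).2 hh

theorem VanishesOn.cubic_dvd_sigma {h : Line F} {S : F[X] × F[X]} (hS : VanishesOn A B S h) :
    h.cubic A B ∣ sigma A B S := by
  have key : sigma A B S =
      h.cubic A B * S.2 ^ 2 + (h.rhs * S.2 + S.1) * (h.rhs * S.2 - S.1) := by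
    simp only [sigma, Line.cubic]
    ring
  rw [key]
  exact dvd_add (dvd_mul_right _ _) (dvd_mul_of_dvd_left hS _)

theorem aeval_cubic {K : Type*} [Field K] [Algebra F K] (x : K) :
    aeval x (cubic A B) = x ^ 3 + algebraMap F K A * x + algebraMap F K B := by
  simp [cubic]

theorem Line.aeval_rhs {K : Type*} [Field K] [Algebra F K] (h : Line F) (x : K) :
    aeval x h.rhs = algebraMap F K h.slope * x + algebraMap F K h.const := by
  simp [Line.rhs]

theorem exists_eval_eq_zero_of_aeval_sigma_eq_zero {K : Type*} [Field K] [IsAlgClosed K]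
    [Algebra F K] {S : F[X] × F[X]} {x : K} (hx : aeval x (sigma A B S) = 0) :
    ∃ y : K, y ^ 2 = x ^ 3 + algebraMap F K A * x + algebraMap F K B ∧
      aeval x S.1 + y * aeval x S.2 = 0 := by
  rw [sigma, map_sub, map_mul, map_pow, map_pow, aeval_cubic] at hx
  by_cases h₂ : aeval x S.2 = 0
  · obtain ⟨y, hy⟩ := IsAlgClosed.exists_pow_nat_eq
      (x ^ 3 + algebraMap F K A * x + algebraMap F K B) two_pos
    have h₁ : aeval x S.1 = 0 := by simpa [h₂] using hx
    exact ⟨y, hy, by rw [h₁, h₂, mul_zero, add_zero]⟩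
  · refine ⟨-aeval x S.1 / aeval x S.2, ?_, by rw [div_mul_cancel₀ _ h₂, add_neg_cancel]⟩
    rw [div_pow, div_eq_iff (pow_ne_zero 2 h₂)]
    linear_combination -hx

variable {L : Type*} [Fintype F] [Field L] [Algebra F L] [DecidableEq L]
  {h : Line F} {Q : ((curve A B)⁄L).Point} {z : Fin 3 → L}

theorem LineOrbit.cubic_eq_minpoly (hdeg : Module.finrank F L = 3) (hz : LineOrbit h Q z) :
    h.cubic A B = minpoly F (z 0) := by
  have : FiniteDimensional F L := .of_finrank_pos (by lia)
  have hintegral := IsIntegral.of_finite F (z 0)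
  have hminpoly : (minpoly F (z 0)).natDegree = 3 := by
    have hdvd := minpoly.degree_dvd hintegral
    rw [hdeg, Nat.dvd_prime Nat.prime_three, minpoly.natDegree_eq_one_iff] at hdvd
    exact hdvd.resolve_left fun ⟨a, ha⟩ => hz.notMem_range a ha
  have hroot : aeval (z 0) (h.cubic A B) = 0 := by
    rw [Line.cubic, map_sub, map_pow, aeval_cubic, Line.aeval_rhs,
      curve_equation_iff.1 (hz.eq_some 0).1.1]
    exact sub_self _
  exact eq_of_monic_of_dvd_of_natDegree_le (minpoly.monic hintegral) h.monic_cubic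
    (minpoly.dvd _ _ hroot) (by rw [hminpoly, h.natDegree_cubic])

theorem IsLineOf.irreducible_cubic (hT : (Nat.card (traceZero L A B)).Coprime 3)
    (hdeg : Module.finrank F L = 3) (hQ : Q ∈ traceZero L A B) (hh : IsLineOf h Q) :
    Irreducible (h.cubic A B) := by
  obtain ⟨z, hz⟩ := hh.exists_lineOrbit hT hQ
  have : FiniteDimensional F L := .of_finrank_pos (by lia)
  exact hz.cubic_eq_minpoly hdeg ▸ minpoly.irreducible (.of_finite F _)

theorem IsS.vanishesOn_iff (hT : (Nat.card (traceZero L A B)).Coprime 3)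
    (hdeg : Module.finrank F L = 3) {S : F[X] × F[X]} {P R : ((curve A B)⁄L).Point}
    (hS : IsS S P R) (hQ : Q ∈ traceZero L A B) (hh : IsLineOf h Q) :
    VanishesOn A B S h ↔ ∃ i j : Fin 3, Q = (frob A B)^[i] P + (frob A B)^[j] R := by
  obtain ⟨z, hz⟩ := hh.exists_lineOrbit hT hQ
  obtain ⟨hn, e⟩ := hz.eq_some 0
  rw [VanishesOn, hz.cubic_eq_minpoly hdeg, minpoly.dvd_iff, show Q = _ from e, map_add, map_mul,
    add_comm, Line.aeval_rhs, hS.eval_eq_zero_iff (curve_equation_iff.1 hn.1)]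
  refine exists_congr fun i => exists_congr fun j => ⟨?_, fun e => ⟨_, _, hn, e.symm, rfl, rfl⟩⟩
  rintro ⟨_, _, _, e, rfl, rfl⟩
  exact e.symm

/-- All irreducible factors of the norm of `S` are cubics of lines from `V` on which `S`
vanishes. -/
def HasZerosIn (A B : F) (V : Set (Line F)) (S : F[X] × F[X]) : Prop :=
  ∀ W : F[X], W.Monic → Irreducible W → W ∣ sigma A B S →
    ∃ h ∈ V, W = h.cubic A B ∧ VanishesOn A B S h

/-- The lines of the points of trace zero. -/
def traceZeroLines (L : Type*) [Field L] [Algebra F L] [DecidableEq L] (A B : F) :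
    Set (Line F) :=
  {h | ∃ Q ∈ traceZero L A B, IsLineOf h Q}

theorem IsS.hasZerosIn (hT : (Nat.card (traceZero L A B)).Coprime 3)
    (hdeg : Module.finrank F L = 3) {S : F[X] × F[X]} {P R : ((curve A B)⁄L).Point}
    (hS : IsS S P R) (hP : P ∈ traceZero L A B) (hR : R ∈ traceZero L A B) :
    HasZerosIn A B (traceZeroLines L A B) S := by
  intro W hW hirr hdvd
  let K := AlgebraicClosure L
  obtain ⟨x, hx⟩ := IsAlgClosed.exists_aeval_eq_zero K W (degree_pos_of_irreducible hirr).ne'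
  obtain ⟨y, hy, hxy⟩ := exists_eval_eq_zero_of_aeval_sigma_eq_zero
    (aeval_eq_zero_of_dvd_aeval_eq_zero hdvd hx)
  obtain ⟨i, j, x', y', h', e, rfl, -⟩ := (hS.eval_eq_zero_iff hy).1 hxy
  have hQ := add_mem (iterate_frob_mem_traceZero hP i) (iterate_frob_mem_traceZero hR j)
  obtain ⟨h, hh⟩ := exists_isLineOf hT hQ (e ▸ WeierstrassCurve.Affine.Point.some_ne_zero h')
  refine ⟨h, ⟨_, hQ, hh⟩, ?_, (hS.vanishesOn_iff hT hdeg hQ hh).2 ⟨i, j, rfl⟩⟩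
  obtain ⟨z, hz⟩ := hh.exists_lineOrbit hT hQ
  obtain ⟨hn, e'⟩ := hz.eq_some 0
  obtain rfl : x' = z 0 := (WeierstrassCurve.Affine.Point.some.inj (e.symm.trans e')).1
  rw [hz.cubic_eq_minpoly hdeg]
  rw [aeval_algebraMap_apply, map_eq_zero_iff _ (algebraMap L K).injective] at hx
  exact minpoly.eq_of_irreducible_of_monic hirr hx hW

end Cubic

section LinearSystem

variable {F : Type*} [Field F] {W : F[X]} {S : F[X] × F[X]}

theorem coeff_linear_mul_zero (a b : F) (p : F[X]) :
    ((C a * X + C b) * p).coeff 0 = b * p.coeff 0 := by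
  simp [mul_coeff_zero]

theorem coeff_linear_mul_succ (a b : F) (p : F[X]) (n : ℕ) :
    ((C a * X + C b) * p).coeff (n + 1) = a * p.coeff n + b * p.coeff (n + 1) := by
  rw [add_mul, mul_assoc, coeff_add, coeff_C_mul, coeff_X_mul, coeff_C_mul]

theorem cubic_dvd_quartic_iff {T : F[X]} (hW : W.Monic) (hW3 : W.natDegree = 3)
    (hW0 : W.coeff 0 ≠ 0) (hT : T.natDegree ≤ 4) :
    W ∣ T ↔
      W.coeff 0 * T.coeff 3 = W.coeff 0 * T.coeff 4 * W.coeff 2 + T.coeff 0 ∧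
      W.coeff 0 * T.coeff 2 = W.coeff 0 * T.coeff 4 * W.coeff 1 + T.coeff 0 * W.coeff 2 ∧
      W.coeff 0 * T.coeff 1 = W.coeff 0 * T.coeff 4 * W.coeff 0 + T.coeff 0 * W.coeff 1 := by
  have hw₃ : W.coeff 3 = 1 := hW3 ▸ hW.coeff_natDegree
  have hw₄ : W.coeff 4 = 0 := coeff_eq_zero_of_natDegree_lt (by lia)
  constructor
  · rintro ⟨D, rfl⟩
    have hD : D.natDegree ≤ 1 := by
      by_cases h0 : D = 0
      · simp [h0]
      · rw [hW.natDegree_mul' h0] at hT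
        lia
    obtain ⟨d₁, d₀, rfl⟩ := exists_eq_X_add_C_of_natDegree_le_one hD
    simp only [mul_comm W, coeff_linear_mul_zero, coeff_linear_mul_succ, hw₃, hw₄]
    refine ⟨?_, ?_, ?_⟩ <;> ring
  · rintro ⟨h₃, h₂, h₁⟩
    refine ⟨C (T.coeff 4) * X + C (T.coeff 0 / W.coeff 0), ?_⟩
    have hD : (W * (C (T.coeff 4) * X + C (T.coeff 0 / W.coeff 0))).natDegree ≤ 4 :=
      natDegree_mul_le_of_le hW3.le natDegree_linear_le
    rw [ext_iff_natDegree_le hT hD]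
    intro i hi
    rw [mul_comm W]
    interval_cases i <;>
      simp only [coeff_linear_mul_zero, coeff_linear_mul_succ, hw₃, hw₄] <;> field_simp
    · linear_combination h₁
    · linear_combination h₂
    · linear_combination h₃
    · ring

/-- The function `S = S₁ + y S₂` is scaled to have leading term `y x³`; that is, its pole at `P_∞`
has order nine. -/
structure IsGeneric (S : F[X] × F[X]) : Prop where
  natDegree_fst_le : S.1.natDegree ≤ 4
  natDegree_snd_le : S.2.natDegree ≤ 3
  coeff_snd : S.2.coeff 3 = 1

theorem IsGeneric.monic_snd (hS : IsGeneric S) : S.2.Monic :=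
  monic_of_natDegree_le_of_coeff_eq_one 3 hS.natDegree_snd_le hS.coeff_snd

theorem IsGeneric.natDegree_snd (hS : IsGeneric S) : S.2.natDegree = 3 :=
  natDegree_eq_of_le_of_coeff_ne_zero hS.natDegree_snd_le (by simp [hS.coeff_snd])

theorem solves_linSys_iff (hS : IsGeneric S) (hW : W.Monic) (hW3 : W.natDegree = 3)
    (hW0 : W.coeff 0 ≠ 0) (g : Line F) :
    Solves (linSys W S) g ↔ W ∣ g.rhs * S.2 + S.1 := by
  have hdeg : (g.rhs * S.2 + S.1).natDegree ≤ 4 :=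
    natDegree_add_le_of_degree_le
      (natDegree_mul_le_of_le natDegree_linear_le hS.natDegree_snd_le) hS.natDegree_fst_le
  have h₄ : S.2.coeff 4 = 0 :=
    coeff_eq_zero_of_natDegree_lt (hS.natDegree_snd_le.trans_lt (by lia))
  rw [cubic_dvd_quartic_iff hW hW3 hW0 hdeg]
  simp only [Solves, Fin.forall_fin_succ, linSys, Matrix.of_apply, Matrix.cons_val,
    Fin.succ_zero_eq_one, Fin.succ_one_eq_two, IsEmpty.forall_iff, and_true]
  simp only [Line.rhs, coeff_add, coeff_linear_mul_zero, coeff_linear_mul_succ, hS.coeff_snd, h₄,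
    zero_add, one_add_one_eq_two]
  refine and_congr ?_ (and_congr ?_ ?_) <;> constructor <;> intro e <;> linear_combination -e

theorem solve_eq_some {M : Matrix (Fin 3) (Fin 3) F} {h : Line F} (hh : Solves M h)
    (hu : ∀ g, Solves M g → g = h) : solve M = some h := by
  have e : ∃! g, Solves M g := ⟨h, hh, hu⟩
  rw [solve, dif_pos e, hu _ e.choose_spec.1]

theorem coeff_zero_ne_zero_of_irreducible (hW : Irreducible W) (hd : 1 < W.natDegree) :
    W.coeff 0 ≠ 0 := fun h0 => by
  have := natDegree_le_of_dvd (irreducible_X.dvd_symm hW (X_dvd_iff.2 h0)) X_ne_zero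
  rw [natDegree_X] at this
  lia

theorem Line.rhs_injective : Function.Injective (Line.rhs : Line F → F[X]) := fun g h e => by
  refine Line.ext ?_ ?_
  · simpa [Line.rhs] using congrArg (coeff · 1) e
  · simpa [Line.rhs] using congrArg (coeff · 0) e

variable {A B : F} {h : Line F}

theorem solve_linSys (hS : IsGeneric S) (hirr : Irreducible (h.cubic A B))
    (hne : h.cubic A B ≠ S.2) (hh : VanishesOn A B S h) :
    solve (linSys (h.cubic A B) S) = some h := by
  have h0 := coeff_zero_ne_zero_of_irreducible hirr (by rw [h.natDegree_cubic]; lia)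
  have key := solves_linSys_iff hS h.monic_cubic h.natDegree_cubic h0
  refine solve_eq_some ((key h).2 hh) fun g hg => Line.rhs_injective (sub_eq_zero.1 ?_)
  have hdvd : h.cubic A B ∣ (g.rhs - h.rhs) * S.2 := by
    rw [sub_mul, ← add_sub_add_right_eq_sub _ _ S.1]
    exact dvd_sub ((key g).1 hg) hh
  have hndvd : ¬h.cubic A B ∣ S.2 := fun hd => hne <|
    (eq_of_monic_of_dvd_of_natDegree_le h.monic_cubic hS.monic_snd hd
      (by rw [hS.natDegree_snd, h.natDegree_cubic])).symm
  refine eq_zero_of_dvd_of_natDegree_lt ((hirr.prime.dvd_or_dvd hdvd).resolve_right hndvd) ?_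
  rw [h.natDegree_cubic]
  exact (natDegree_sub_le_of_le natDegree_linear_le natDegree_linear_le).trans_lt (by lia)

end LinearSystem

section CubicFactors

variable {F : Type*} [Field F] {A B : F} {S : F[X] × F[X]}

theorem IsGeneric.sigma_ne_zero (hS : IsGeneric S) : sigma A B S ≠ 0 := by
  have hmonic : (cubic A B).Monic := by
    rw [cubic, add_assoc]
    exact monic_X_pow_add (by compute_degree!)
  have hdeg : (cubic A B).natDegree = 3 := by
    rw [cubic]
    compute_degree!
  have h₂ : (cubic A B * S.2 ^ 2).natDegree = 9 := by
    rw [hmonic.natDegree_mul (hS.monic_snd.pow 2), hS.monic_snd.natDegree_pow, hS.natDegree_snd,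
      hdeg]
  have h₁ : (S.1 ^ 2).natDegree ≤ 8 := natDegree_pow_le_of_le 2 hS.natDegree_fst_le
  intro e
  rw [sigma, sub_eq_zero] at e
  rw [e] at h₂
  lia

theorem dvd_fst_of_dvd_sigma {W : F[X]} (hirr : Irreducible W) (hσ : W ∣ sigma A B S)
    (h₂ : W ∣ S.2) : W ∣ S.1 := by
  refine hirr.prime.dvd_of_dvd_pow (n := 2) ?_
  rw [show S.1 ^ 2 = cubic A B * S.2 ^ 2 - sigma A B S from (sub_sub_cancel _ _).symm]
  exact dvd_sub ((h₂.pow two_ne_zero).mul_left _) hσ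

theorem mem_cubicFactors_iff {G W : F[X]} (hG : G ≠ 0) :
    W ∈ cubicFactors G ↔ W.Monic ∧ Irreducible W ∧ W ∣ G ∧ W.natDegree = 3 := by
  classical
  simp only [cubicFactors, Finset.mem_filter, Multiset.mem_toFinset,
    UniqueFactorizationMonoid.mem_normalizedFactors_iff' hG]
  constructor
  · rintro ⟨⟨hirr, hnorm, hdvd⟩, hdeg⟩
    exact ⟨hnorm ▸ monic_normalize hirr.ne_zero, hirr, hdvd, hdeg⟩
  · rintro ⟨hmonic, hirr, hdvd, hdeg⟩
    exact ⟨⟨hirr, hmonic.normalize_eq_self, hdvd⟩, hdeg⟩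

theorem monicOf_eq {g W : F[X]} (hg : g ≠ 0) (hW : W.Monic) (hd : g.natDegree ≤ W.natDegree)
    (hdvd : W ∣ g) : monicOf g = W := by
  refine eq_of_monic_of_dvd_of_natDegree_le hW ?_ (hdvd.mul_left _)
    ((natDegree_C_mul_le _ _).trans hd)
  rw [monicOf, mul_comm]
  exact monic_mul_leadingCoeff_inv hg

end CubicFactors

section Correctness

variable {F : Type*} [Field F] {A B : F} {V : Set (Line F)} {h : Line F} {S₁ S₂ : F[X] × F[X]}

/-- A set of lines that is stable under the negation of the curve, which fixes none of them, and
whose cubics are irreducible; the lines of the points of trace zero are such a set. -/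
structure IsAdmissible (A B : F) (V : Set (Line F)) : Prop where
  neg_mem : ∀ g ∈ V, g.neg ∈ V
  neg_ne : ∀ g ∈ V, g.neg ≠ g
  irreducible_cubic : ∀ g ∈ V, Irreducible (g.cubic A B)

/-- Among the lines of `V`, only `h` has its intersection with the curve in the zero sets of both
`S₁` and `S₂`. -/
structure IsUniqueCommonZero (A B : F) (V : Set (Line F)) (S₁ S₂ : F[X] × F[X]) (h : Line F) :
    Prop where
  mem : h ∈ V
  vanishesOn_left : VanishesOn A B S₁ h
  vanishesOn_right : VanishesOn A B S₂ h
  unique : ∀ g ∈ V, VanishesOn A B S₁ g → VanishesOn A B S₂ g → g = h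

theorem IsUniqueCommonZero.symm (hh : IsUniqueCommonZero A B V S₁ S₂ h) :
    IsUniqueCommonZero A B V S₂ S₁ h :=
  ⟨hh.mem, hh.vanishesOn_right, hh.vanishesOn_left, fun g hg h₂ h₁ => hh.unique g hg h₁ h₂⟩

theorem IsUniqueCommonZero.not_cubic_dvd_snd (hh : IsUniqueCommonZero A B V S₁ S₂ h)
    (hV : IsAdmissible A B V) (hS₁ : h.cubic A B ∣ S₁.2) : ¬h.cubic A B ∣ S₂.2 := fun hS₂ =>
  hV.neg_ne h hh.mem <| hh.unique _ (hV.neg_mem h hh.mem) (hh.vanishesOn_left.neg hS₁)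
    (hh.vanishesOn_right.neg hS₂)

theorem factorLoop_eq_some (hV : IsAdmissible A B V) (hS₁ : IsGeneric S₁) (hS₂ : IsGeneric S₂)
    (hz₁ : HasZerosIn A B V S₁) (hz₂ : HasZerosIn A B V S₂)
    (hh : IsUniqueCommonZero A B V S₁ S₂ h) {l : List F[X]}
    (hl : ∀ W ∈ l, W.Monic ∧ Irreducible W ∧ W ∣ sigma A B S₁ ∧ W ∣ sigma A B S₂)
    (hmem : h.cubic A B ∈ l) : factorLoop S₁ S₂ l = some h := by
  induction l with
  | nil => simp at hmem
  | cons W l ih =>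
    obtain ⟨hmonic, hirr, hd₁, hd₂⟩ := hl W List.mem_cons_self
    rw [factorLoop]
    split_ifs with hW
    · obtain ⟨g, hg, rfl, hg₁⟩ := hz₁ W hmonic hirr hd₁
      by_cases hgh : h.cubic A B = g.cubic A B
      · rw [← hgh] at hW ⊢
        rw [solve_linSys hS₁ (hV.irreducible_cubic h hh.mem) hW hh.vanishesOn_left]
        exact if_pos hh.vanishesOn_right
      · have hg₂ : ¬VanishesOn A B S₂ g := fun hg₂ => hgh (by rw [hh.unique g hg hg₁ hg₂])
        rw [solve_linSys hS₁ hirr hW hg₁]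
        exact (if_neg hg₂).trans <| ih (fun W hW => hl W (List.mem_cons_of_mem _ hW))
          ((List.mem_cons.1 hmem).resolve_left hgh)
    · rw [ne_eq, not_not] at hW
      obtain ⟨g, hg, rfl, hg₂⟩ := hz₂ W hmonic hirr hd₂
      have hg₁ : VanishesOn A B S₁ g :=
        (vanishesOn_iff_of_dvd_snd hW.dvd).2 (dvd_fst_of_dvd_sigma hirr hd₁ hW.dvd)
      obtain rfl := hh.unique g hg hg₁ hg₂
      exact solve_linSys hS₂ hirr (fun e => hh.not_cubic_dvd_snd hV hW.dvd e.dvd) hg₂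

theorem solve_linSys_monicOf (hV : IsAdmissible A B V) (h₂ : S₁.2 = 0) (h₁ : S₁.1.natDegree ≤ 3)
    (h0 : S₁ ≠ 0) (hS₂ : S₂.2 = 0 ∨ IsGeneric S₂) (hh : IsUniqueCommonZero A B V S₁ S₂ h) :
    solve (linSys (monicOf S₁.1) S₂) = some h := by
  have hdvd : h.cubic A B ∣ S₁.2 := h₂ ▸ dvd_zero _
  have hW : monicOf S₁.1 = h.cubic A B :=
    monicOf_eq (fun e => h0 (Prod.ext e h₂)) h.monic_cubic (h.natDegree_cubic.symm ▸ h₁)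
      ((vanishesOn_iff_of_dvd_snd hdvd).1 hh.vanishesOn_left)
  have hndvd := hh.not_cubic_dvd_snd hV hdvd
  rcases hS₂ with hS₂ | hS₂
  · exact absurd (hS₂ ▸ dvd_zero _) hndvd
  · rw [hW]
    exact solve_linSys hS₂ (hV.irreducible_cubic h hh.mem) (fun e => hndvd e.dvd)
      hh.vanishesOn_right

theorem factorLoop_cubicFactors_eq_some (hV : IsAdmissible A B V) (hS₁ : IsGeneric S₁)
    (hS₂ : IsGeneric S₂) (hz₁ : HasZerosIn A B V S₁) (hz₂ : HasZerosIn A B V S₂)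
    (hh : IsUniqueCommonZero A B V S₁ S₂ h) {order : Finset F[X] → List F[X]}
    (horder : ∀ s W, W ∈ order s ↔ W ∈ s) :
    open Classical in factorLoop S₁ S₂
      (order (cubicFactors (EuclideanDomain.gcd (sigma A B S₁) (sigma A B S₂)))) = some h := by
  classical
  have hG : EuclideanDomain.gcd (sigma A B S₁) (sigma A B S₂) ≠ 0 := fun e =>
    hS₁.sigma_ne_zero (EuclideanDomain.gcd_eq_zero_iff.1 e).1
  refine factorLoop_eq_some hV hS₁ hS₂ hz₁ hz₂ hh (fun W hW => ?_) ?_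
  · rw [horder, mem_cubicFactors_iff hG] at hW
    obtain ⟨hmonic, hirr, hdvd, -⟩ := hW
    exact ⟨hmonic, hirr, hdvd.trans (EuclideanDomain.gcd_dvd_left _ _),
      hdvd.trans (EuclideanDomain.gcd_dvd_right _ _)⟩
  · rw [horder, mem_cubicFactors_iff hG]
    exact ⟨h.monic_cubic, hV.irreducible_cubic h hh.mem, EuclideanDomain.dvd_gcd
      hh.vanishesOn_left.cubic_dvd_sigma hh.vanishesOn_right.cubic_dvd_sigma, h.natDegree_cubic⟩

end Correctness

section Scaling

variable {F : Type*} [Field F] {A B : F} {h k : Line F}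

theorem coeff_sRaw_snd :
    (sRaw A B h k).2.coeff 3 = sCoeffB3 A B h.slope h.const k.slope k.const := by
  simp [sRaw, coeff_X_pow]

theorem natDegree_sRaw_fst_le : (sRaw A B h k).1.natDegree ≤ 4 := by
  have key (a b c d e : F) :
      (C a * X ^ 4 + C b * X ^ 3 + C c * X ^ 2 + C d * X + C e).natDegree ≤ 4 := by
    compute_degree
  exact key ..

theorem isGeneric_sPoly (hc : sCoeffB3 A B h.slope h.const k.slope k.const ≠ 0) :
    IsGeneric (sPoly A B h k) := by
  rw [← coeff_sRaw_snd] at hc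
  simp only [sPoly, if_neg hc]
  exact ⟨(natDegree_C_mul_le _ _).trans natDegree_sRaw_fst_le,
    (natDegree_C_mul_le _ _).trans natDegree_cubic_le, by rw [coeff_C_mul, inv_mul_cancel₀ hc]⟩

theorem sRaw_neg_snd (h : Line F) : (sRaw A B h.neg h).2 = 0 := by
  have h₃ : sCoeffB3 A B (-h.slope) (-h.const) h.slope h.const = 0 := by rw [sCoeffB3]; ring
  have h₂ : sCoeffB2 A B (-h.slope) (-h.const) h.slope h.const = 0 := by rw [sCoeffB2]; ring
  have h₁ : sCoeffB1 A B (-h.slope) (-h.const) h.slope h.const = 0 := by rw [sCoeffB1]; ring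
  have h₀ : sCoeffB0 A B (-h.slope) (-h.const) h.slope h.const = 0 := by rw [sCoeffB0]; ring
  simp [sRaw, Line.neg, h₃, h₂, h₁, h₀]

theorem natDegree_sRaw_neg_fst_le (h : Line F) : (sRaw A B h.neg h).1.natDegree ≤ 3 := by
  have h₄ : sCoeffA4 A B (-h.slope) (-h.const) h.slope h.const = 0 := by rw [sCoeffA4]; ring
  simp only [sRaw, Line.neg, h₄, C_0, zero_mul, zero_add]
  exact natDegree_cubic_le

theorem sPoly_neg (h : Line F) : sPoly A B h.neg h = sRaw A B h.neg h := by
  rw [sPoly, if_pos (by rw [sRaw_neg_snd, coeff_zero])]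

theorem solve_linSys_monicOf_sPoly_neg {V : Set (Line F)} {S : F[X] × F[X]}
    (hV : IsAdmissible A B V) (h0 : sPoly A B k.neg k ≠ 0) (hS : S.2 = 0 ∨ IsGeneric S)
    (hh : IsUniqueCommonZero A B V (sPoly A B k.neg k) S h) :
    solve (linSys (monicOf (sPoly A B k.neg k).1) S) = some h := by
  rw [sPoly_neg] at *
  exact solve_linSys_monicOf hV (sRaw_neg_snd k) (natDegree_sRaw_neg_fst_le k) h0 hS hh

theorem IsIntersection.map_sCoeffB3 {R : Type*} [CommRing R] {φ : F →+* R} {z : Fin 3 → R}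
    (hz : IsIntersection (φ A) (φ B) (φ h.slope) (φ h.const) z) :
    φ (sCoeffB3 A B h.slope h.const k.slope k.const) =
      -∏ i, (φ (k.neg.slope - h.slope) * z i + φ (k.neg.const - h.const)) := by
  obtain ⟨h₁, h₂, h₃⟩ := hz
  simp only [sCoeffB3, Line.neg, Fin.prod_univ_three, map_add, map_sub, map_neg, map_mul, map_pow,
    map_ofNat]
  generalize φ h.slope = α₁, φ h.const = α₀, φ k.slope = β₁, φ k.const = β₀ at *
  linear_combination -(α₁ + β₁) ^ 3 * h₃ - (α₁ + β₁) ^ 2 * (α₀ + β₀) * h₂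
    - (α₁ + β₁) * (α₀ + β₀) ^ 2 * h₁

variable {L : Type*} [Fintype F] [Field L] [Algebra F L] [DecidableEq L]

theorem IsLineOf.isGeneric_sPoly {Q : ((curve A B)⁄L).Point}
    (hT : (Nat.card (traceZero L A B)).Coprime 3) (hh : IsLineOf h Q)
    (hQ : Q ∈ traceZero L A B) (hne : h ≠ k.neg) : IsGeneric (sPoly A B h k) := by
  obtain ⟨z, hz⟩ := hh.exists_lineOrbit hT hQ
  refine TraceZero.isGeneric_sPoly fun hc => hz.prod_ne_zero hQ hne.symm ?_
  rw [← neg_eq_zero, ← hz.isIntersection.map_sCoeffB3, hc, map_zero]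

theorem IsLineOf.sPoly_snd_eq_zero_or_isGeneric {Q : ((curve A B)⁄L).Point}
    (hT : (Nat.card (traceZero L A B)).Coprime 3) (hh : IsLineOf h Q)
    (hQ : Q ∈ traceZero L A B) (k : Line F) :
    (sPoly A B h k).2 = 0 ∨ IsGeneric (sPoly A B h k) := by
  by_cases hne : h = k.neg
  · rw [hne, sPoly_neg]
    exact .inl (sRaw_neg_snd k)
  · exact .inr (hh.isGeneric_sPoly hT hQ hne)

end Scaling

section Generic

variable {F L : Type*} [Field F] [Fintype F] [Field L] [Algebra F L] [DecidableEq L] {A B : F}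
  {Q R Q' R' : ((curve A B)⁄L).Point} {S₁ S₂ : F[X] × F[X]} {h h₁ h₂ k₁ k₂ : Line F}

theorem IsLineOf.neg_add (hT : (Nat.card (traceZero L A B)).Coprime 3) (hQ : Q ∈ traceZero L A B)
    (hh : IsLineOf h Q) (hh' : IsLineOf h R) (hne : Q ≠ R) : IsLineOf h.neg (Q + R) := by
  obtain ⟨z, hz⟩ := hh.exists_lineOrbit hT hQ
  obtain ⟨i, rfl⟩ := hz.exists_eq_iterate_of_contains hh'.1
  have hsum := mem_traceZero.1 hQ
  fin_cases i
  · exact absurd rfl hne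
  · exact neg_eq_of_add_eq_zero_left hsum ▸ (hh.iterate_frob 2).neg
  · rw [add_right_comm] at hsum
    exact neg_eq_of_add_eq_zero_left hsum ▸ (hh.iterate_frob 1).neg

theorem isLineOf_iterate_add_iff (hQ : Q ∈ traceZero L A B) (hR : R ∈ traceZero L A B)
    (i j : Fin 3) : IsLineOf h ((frob A B)^[i] Q + (frob A B)^[j] R) ↔
      IsLineOf h (Q + (frob A B)^[(j - i : Fin 3)] R) := by
  have hR3 : (frob A B)^[i + (j - i : Fin 3)] R = (frob A B)^[j] R := by
    fin_cases i <;> fin_cases j <;>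
      first | rfl | exact frob_frob_frob hR | exact frob_frob_frob (frob_mem_traceZero hR)
  rw [← isLineOf_iterate_frob_iff (add_mem hQ (iterate_frob_mem_traceZero hR _)) i,
    iterate_map_add, ← Function.iterate_add_apply, hR3]

theorem IsLineOf.neg_ne (hT₂ : (Nat.card (traceZero L A B)).Coprime 2)
    (hT₃ : (Nat.card (traceZero L A B)).Coprime 3) (hQ : Q ∈ traceZero L A B)
    (hh : IsLineOf h Q) : h.neg ≠ h := fun e => by
  obtain ⟨z, hz⟩ := hh.exists_lineOrbit hT₃ hQ
  obtain ⟨i, hi⟩ := hz.exists_eq_iterate_of_contains (e ▸ hh.1.neg)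
  fin_cases i
  · refine hh.ne_zero (eq_zero_of_coprime_of_nsmul_eq_zero hT₂ hQ ?_)
    rw [two_nsmul]
    exact neg_eq_iff_add_eq_zero.1 hi
  · exact frob_ne_neg hQ hh.ne_zero hi.symm
  · exact frob_frob_ne_neg hQ hh.ne_zero hi.symm

theorem isAdmissible_traceZeroLines (hT₂ : (Nat.card (traceZero L A B)).Coprime 2)
    (hT₃ : (Nat.card (traceZero L A B)).Coprime 3) (hdeg : Module.finrank F L = 3) :
    IsAdmissible A B (traceZeroLines L A B) where
  neg_mem := fun _ ⟨Q, hQ, hg⟩ => ⟨-Q, neg_mem hQ, hg.neg⟩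
  neg_ne := fun _ ⟨_, hQ, hg⟩ => hg.neg_ne hT₂ hT₃ hQ
  irreducible_cubic := fun _ ⟨_, hQ, hg⟩ => hg.irreducible_cubic hT₃ hdeg hQ

theorem IsS.isUniqueCommonZero (hT : (Nat.card (traceZero L A B)).Coprime 3)
    (hdeg : Module.finrank F L = 3) (hS₁ : IsS S₁ Q R) (hS₂ : IsS S₂ Q' R')
    (hQ : Q ∈ traceZero L A B) (hR : R ∈ traceZero L A B) (hQ' : Q' ∈ traceZero L A B)
    (hR' : R' ∈ traceZero L A B) (hadd : Q' + R' = Q + R)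
    (hgeneric : ∀ i ∈ ({1, 2} : Set ℕ), ∀ j ∈ ({1, 2} : Set ℕ), ∀ h k : Line F,
      IsLineOf h (Q + (frob A B)^[i] R) → IsLineOf k (Q' + (frob A B)^[j] R') → h ≠ k)
    (hh : IsLineOf h (Q + R)) :
    IsUniqueCommonZero A B (traceZeroLines L A B) S₁ S₂ h where
  mem := ⟨_, add_mem hQ hR, hh⟩
  vanishesOn_left := (hS₁.vanishesOn_iff hT hdeg (add_mem hQ hR) hh).2 ⟨0, 0, rfl⟩
  vanishesOn_right := (hS₂.vanishesOn_iff hT hdeg (add_mem hQ hR) hh).2 ⟨0, 0, hadd.symm⟩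
  unique := by
    rintro g ⟨Z, hZ, hg⟩ hg₁ hg₂
    obtain ⟨i, j, e₁⟩ := (hS₁.vanishesOn_iff hT hdeg hZ hg).1 hg₁
    obtain ⟨k, l, e₂⟩ := (hS₂.vanishesOn_iff hT hdeg hZ hg).1 hg₂
    have hgQ := (isLineOf_iterate_add_iff hQ hR i j).1 (e₁ ▸ hg)
    have hgQ' := (isLineOf_iterate_add_iff hQ' hR' k l).1 (e₂ ▸ hg)
    have hmem : ∀ d : Fin 3, d ≠ 0 → (d : ℕ) ∈ ({1, 2} : Set ℕ) := by decide
    by_cases hij : j - i = 0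
    · rw [hij] at hgQ
      exact hh.unique hT (add_mem hQ hR) hgQ
    by_cases hkl : l - k = 0
    · rw [hkl] at hgQ'
      exact hh.unique hT (add_mem hQ hR) (hadd ▸ hgQ')
    exact absurd rfl (hgeneric _ (hmem _ hij) _ (hmem _ hkl) g g hgQ hgQ')

theorem subalgorithm_eq_some (hT₂ : (Nat.card (traceZero L A B)).Coprime 2)
    (hT₃ : (Nat.card (traceZero L A B)).Coprime 3) (hdeg : Module.finrank F L = 3)
    (hQ : Q ∈ traceZero L A B) (hR : R ∈ traceZero L A B) (hQ' : Q' ∈ traceZero L A B)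
    (hR' : R' ∈ traceZero L A B) (hadd : Q' + R' = Q + R) (hQR : Q ≠ R) (hQR' : Q' ≠ R')
    (hh₁ : IsLineOf h₁ Q) (hh₂ : IsLineOf h₂ R) (hk₁ : IsLineOf k₁ Q') (hk₂ : IsLineOf k₂ R')
    (hgeneric : ∀ i ∈ ({1, 2} : Set ℕ), ∀ j ∈ ({1, 2} : Set ℕ), ∀ h k : Line F,
      IsLineOf h (Q + (frob A B)^[i] R) → IsLineOf k (Q' + (frob A B)^[j] R') → h ≠ k)
    {order : Finset F[X] → List F[X]} (horder : ∀ s W, W ∈ order s ↔ W ∈ s)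
    (hh : IsLineOf h (Q + R)) : subalgorithm A B order h₁ h₂ k₁ k₂ = some h := by
  have hM := add_mem hQ hR
  rw [subalgorithm]
  split_ifs with hh₁₂ hk₁₂ hneg hneg'
  · exact congrArg some (hh.unique hT₃ hM (hh₁.neg_add hT₃ hQ (hh₁₂ ▸ hh₂) hQR))
  · exact congrArg some (hh.unique hT₃ hM (hadd ▸ hk₁.neg_add hT₃ hQ' (hk₁₂ ▸ hk₂) hQR'))
  all_goals
    have hV := isAdmissible_traceZeroLines hT₂ hT₃ hdeg
    have hS₁ := hh₁.isS_sPoly hT₃ hh₂ hQ hR hh₁₂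
    have hS₂ := hk₁.isS_sPoly hT₃ hk₂ hQ' hR' hk₁₂
    have hcommon := hS₁.isUniqueCommonZero hT₃ hdeg hS₂ hQ hR hQ' hR' hadd hgeneric hh
  · subst hneg
    exact solve_linSys_monicOf_sPoly_neg hV hS₁.ne_zero
      (hk₁.sPoly_snd_eq_zero_or_isGeneric hT₃ hQ' k₂) hcommon
  · subst hneg'
    exact solve_linSys_monicOf_sPoly_neg hV hS₂.ne_zero
      (.inr (hh₁.isGeneric_sPoly hT₃ hQ hneg)) hcommon.symm
  · exact factorLoop_cubicFactors_eq_some hV (hh₁.isGeneric_sPoly hT₃ hQ hneg)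
      (hk₁.isGeneric_sPoly hT₃ hQ' hneg') (hS₁.hasZerosIn hT₃ hdeg hQ hR)
      (hS₂.hasZerosIn hT₃ hdeg hQ' hR') hcommon horder

end Generic

theorem zsmul_ne_zero_of_lt_card_zmultiples {G : Type*} [AddGroup G] {P : G} {m : ℤ} (hm : 0 < m)
    (hmP : m < Nat.card (AddSubgroup.zmultiples P)) : m • P ≠ 0 := fun e =>
  (Int.le_of_dvd hm (addOrderOf_dvd_iff_zsmul_eq_zero.2 e)).not_gt (Nat.card_zmultiples P ▸ hmP)

end

end TraceZero

theorem mainTheorem4_general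
    {F L : Type*} [Field F] [Fintype F] [Field L] [Algebra F L] [DecidableEq L] {A B : F}
    (hdeg : Module.finrank F L = 3)
    (hT₂ : (Nat.card (TraceZero.traceZero L A B)).Coprime 2)
    (hT₃ : (Nat.card (TraceZero.traceZero L A B)).Coprime 3)
    {Q R Q' R' M : ((TraceZero.curve A B)⁄L).Point}
    (hQ : Q ∈ TraceZero.traceZero L A B) (hR : R ∈ TraceZero.traceZero L A B)
    (hQ' : Q' ∈ TraceZero.traceZero L A B) (hR' : R' ∈ TraceZero.traceZero L A B)
    (hM : Q + R = M) (hM' : Q' + R' = M) (hM0 : M ≠ 0) (hQR : Q ≠ R) (hQR' : Q' ≠ R')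
    {h₁ h₂ k₁ k₂ : TraceZero.Line F}
    (hh₁ : TraceZero.IsLineOf h₁ Q) (hh₂ : TraceZero.IsLineOf h₂ R)
    (hk₁ : TraceZero.IsLineOf k₁ Q') (hk₂ : TraceZero.IsLineOf k₂ R')
    (hgeneric : ∀ i ∈ ({1, 2} : Set ℕ), ∀ j ∈ ({1, 2} : Set ℕ), ∀ h k : TraceZero.Line F,
      TraceZero.IsLineOf h (Q + (TraceZero.frob A B)^[i] R) →
      TraceZero.IsLineOf k (Q' + (TraceZero.frob A B)^[j] R') → h ≠ k)
    {order : Finset F[X] → List F[X]} (horder : ∀ s W, W ∈ order s ↔ W ∈ s) :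
    (h₁ ≠ h₂ → TraceZero.IsS (TraceZero.sPoly A B h₁ h₂) Q R) ∧
    (k₁ ≠ k₂ → TraceZero.IsS (TraceZero.sPoly A B k₁ k₂) Q' R') ∧
    ∃ h : TraceZero.Line F, TraceZero.IsLineOf h M ∧
      (∀ h', TraceZero.IsLineOf h' M → h' = h) ∧
      TraceZero.subalgorithm A B order h₁ h₂ k₁ k₂ = some h := by
  subst hM
  have hMT := add_mem hQ hR
  obtain ⟨h, hh⟩ := TraceZero.exists_isLineOf hT₃ hMT hM0
  exact ⟨hh₁.isS_sPoly hT₃ hh₂ hQ hR, hk₁.isS_sPoly hT₃ hk₂ hQ' hR', h, hh,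
    fun _ => hh.unique hT₃ hMT, TraceZero.subalgorithm_eq_some hT₂ hT₃ hdeg hQ hR hQ' hR' hM' hQR
      hQR' hh₁ hh₂ hk₁ hk₂ hgeneric horder hh⟩

theorem mainTheorem4
    {F L : Type*} [Field F] [Fintype F] [Field L] [Algebra F L] [DecidableEq L]
    (hchar2 : ringChar F ≠ 2) (hchar3 : ringChar F ≠ 3)
    (hdeg : Module.finrank F L = 3)
    (A B : F) (hf : (TraceZero.cubic A B).Separable)
    -- the trace-zero subgroup is cyclic of prime order `p > 3`, generated by `P`
    (p : ℕ) (hp : p.Prime) (hp3 : 3 < p)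
    (P : ((TraceZero.curve A B)⁄L).Point)
    (hgen : TraceZero.traceZero L A B = AddSubgroup.zmultiples P)
    (hcard : Nat.card (TraceZero.traceZero L A B) = p)
    (m m₁ m₂ n₁ n₂ : ℤ) (hm0 : 0 < m) (hmp : m < p) (hodd : Odd m)
    (hm : m₁ + m₂ = m) (hn : n₁ + n₂ = m)
    -- automatic when `m₁, m₂, n₁, n₂` are positive
    (hmne : m₁ • P ≠ m₂ • P) (hnne : n₁ • P ≠ n₂ • P)
    -- the input lines
    (h₁ h₂ k₁ k₂ : TraceZero.Line F)
    (hh₁ : TraceZero.IsLineOf h₁ (m₁ • P)) (hh₂ : TraceZero.IsLineOf h₂ (m₂ • P))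
    (hk₁ : TraceZero.IsLineOf k₁ (n₁ • P)) (hk₂ : TraceZero.IsLineOf k₂ (n₂ • P))
    -- none of the lines of `m₁P + φⁱ(m₂P)` is one of the lines of `n₁P + φʲ(n₂P)`, for `i, j = 1, 2`
    (hgeneric : ∀ i ∈ ({1, 2} : Set ℕ), ∀ j ∈ ({1, 2} : Set ℕ), ∀ h k : TraceZero.Line F,
      TraceZero.IsLineOf h (m₁ • P + (TraceZero.frob A B)^[i] (m₂ • P)) →
      TraceZero.IsLineOf k (n₁ • P + (TraceZero.frob A B)^[j] (n₂ • P)) → h ≠ k)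
    -- any order of the cubic factors in the loop
    (order : Finset F[X] → List F[X])
    (horder : ∀ s : Finset F[X], (order s).Nodup ∧ ∀ W, W ∈ order s ↔ W ∈ s) :
    -- the polynomials computed from the lines are `S_{m₁P, m₂P}` and `S_{n₁P, n₂P}`
    (h₁ ≠ h₂ → TraceZero.IsS (TraceZero.sPoly A B h₁ h₂) (m₁ • P) (m₂ • P)) ∧
    (k₁ ≠ k₂ → TraceZero.IsS (TraceZero.sPoly A B k₁ k₂) (n₁ • P) (n₂ • P)) ∧
    -- the line of `mP` exists, is unique, and is returned
    ∃ h : TraceZero.Line F, TraceZero.IsLineOf h (m • P) ∧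
      (∀ h', TraceZero.IsLineOf h' (m • P) → h' = h) ∧
      TraceZero.subalgorithm A B order h₁ h₂ k₁ k₂ = some h := by
  have hmem (n : ℤ) : n • P ∈ TraceZero.traceZero L A B :=
    hgen ▸ AddSubgroup.zsmul_mem_zmultiples P n
  subst hcard
  exact mainTheorem4_general hdeg ((Nat.coprime_primes hp Nat.prime_two).2 (by lia))
    ((Nat.coprime_primes hp Nat.prime_three).2 hp3.ne') (hmem m₁) (hmem m₂) (hmem n₁) (hmem n₂)
    (by rw [← add_zsmul, hm]) (by rw [← add_zsmul, hn])
    (TraceZero.zsmul_ne_zero_of_lt_card_zmultiples hm0 (hgen ▸ hmp)) hmne hnne hh₁ hh₂ hk₁ hk₂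
    hgeneric fun s => (horder s).2
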